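/- Fix countably infinite, pairwise disjoint sets of individuals $\mathbf I$, variables, atomic concepts and atomic roles. A role is $P$ or $P^-$ for an atomic role $P$; a concept is an atomic concept or $\exists R$ for a role $R$. A $\textit{DL-Lite}_{\textit{core}}$ TBox is a finite set of axioms $C\sqsubseteq D$ and $\mathsf{Disj}(C,D)$ with $C,D$ concepts. A bag over $M$ is a function $M\to\mathbb N\cup\{\infty\}$; a bag ABox is a finite bag (finitely many nonzero multiplicities, all finite) of assertions $A(a)$, $P(a,b)$ with $a,b\in\mathbf I$. A bag interpretation $\mathcal I$ has a non-empty domain $\Delta$, maps individuals injectively to elements $a^{\mathcal I}\in\Delta$, and maps atomic concepts and roles to bags over $\Delta$ and $\Delta\times\Delta$; $(P^-)^{\mathcal I}(u,v)=P^{\mathcal I}(v,u)$ and $(\exists R)^{\mathcal I}(u)=\sum_{v}R^{\mathcal I}(u,v)$. It is a bag model of $\langle\mathcal T,\mathcal A\rangle$ if $C^{\mathcal I}\le D^{\mathcal I}$ pointwise for each $C\sqsubseteq D$ in $\mathcal T$, $\min(C^{\mathcal I},D^{\mathcal I})=0$ pointwise for each $\mathsf{Disj}(C,D)$ in $\mathcal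 T$, and $\mathcal A(A(a))\le A^{\mathcal I}(a^{\mathcal I})$, $\mathcal A(P(a,b))\le P^{\mathcal I}(a^{\mathcal I},b^{\mathcal I})$ for all assertions. The ontology is satisfiable if it has a bag model. A CQ is $q(\mathbf x)=\exists\mathbf y.\,\phi(\mathbf x,\mathbf y)$, where $\mathbf x,\mathbf y$ are disjoint repetition-free tuples of variables and $\phi$ is a non-empty conjunction (possibly with repetitions) of atoms $A(t)$, $P(t_1,t_2)$ and equalities $z=t$, with $z\in\mathbf x\cup\mathbf y$ and $t,t_1,t_2\in\mathbf x\cup\mathbf y\cup\mathbf I$. The equalities generate an equivalence relation on $\mathbf x\cup\mathbf y\cup\mathbf I$; CQs are safe: the class of each variable of $\mathbf x\cup\mathbf y$ contains a term mentioned in a non-equality atom. The Gaifman graph has as nodes the classes of the terms in $\phi$ and an edge between the classes of $t_1,t_2$ for each atom over $t_1,t_2$; $q$ is rooted if each connected component has a node containing a term of $\mathbf x\cup\mathbf I$. The bag answers are $q^{\mathcal I}(\mathbf a)=\sum_\lambda\prod_{S(\mathbf t)\text{ in }\phi}S^{\mathcal I}(\lambda(\mathbf t))$ for tuples $\mathbf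 a$ of individuals, where $\lambda$ ranges over the maps $\mathbf x\cup\mathbf y\cup\mathbf I\to\Delta$ with $\lambda(\mathbf x)=\mathbf a^{\mathcal I}$, $\lambda(a)=a^{\mathcal I}$ for $a\in\mathbf I$, and $\lambda(z)=\lambda(t)$ for each equality $z=t$ of $\phi$, and the product is over the non-equality atoms with repetitions. The bag certain answers $q^{\langle\mathcal T,\mathcal A\rangle}$ are the pointwise infimum of $q^{\mathcal I}$ over all bag models $\mathcal I$ of $\langle\mathcal T,\mathcal A\rangle$. $\textsc{BALG}^1_\varepsilon$-queries $q(\mathbf x)$ are built as follows: atoms $S(\mathbf t)$ with $\mathbf t$ over $\mathbf x\cup\mathbf I$ mentioning all of $\mathbf x$; joins $q_1(\mathbf x_1)\wedge q_2(\mathbf x_2)$ with $\mathbf x=\mathbf x_1\cup\mathbf x_2$; selections $q_0(\mathbf x_0)\wedge(x=t)$ with $x\in\mathbf x_0$, $t$ a variable or an individual, and $\mathbf x=\mathbf x_0\cup(\{t\}\setminus\mathbf I)$; projections $\exists\mathbf y.\,q_0(\mathbf x,\mathbf y)$; max unions $q_1(\mathbf x)\vee q_2(\mathbf x)$; arithmetic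 unions $q_1(\mathbf x)\uplus q_2(\mathbf x)$; differences $q_1(\mathbf x)\setminus q_2(\mathbf x)$. Their bag answers over a bag interpretation are defined inductively: the multiplicity of the image tuple for an atom; the product of multiplicities for a join; the multiplicity of $q_0$ if the equality holds and $0$ otherwise for a selection; the sum over all values of $\mathbf y$ in $\Delta$ for a projection; and maximum, sum and truncated difference $\max\{0,m-n\}$ for the last three. Theorem. For every rooted CQ $q(\mathbf x)$ and every $\textit{DL-Lite}_{\textit{core}}$ TBox $\mathcal T$ there is a $\textsc{BALG}^1_\varepsilon$-query $\bar q(\mathbf x)$ with the same answer variables such that, for every bag ABox $\mathcal A$ with $\langle\mathcal T,\mathcal A\rangle$ satisfiable, $q^{\langle\mathcal T,\mathcal A\rangle}=\bar q^{\,\mathcal I_{\mathcal A}}$ as bags of tuples over $\mathbf I$. Here $\mathcal I_{\mathcal A}$ is the bag ABox $\mathcal A$ viewed as a bag interpretation (its least bag model): its domain is $\mathbf I$, each individual denotes itself, and atomic concepts and roles have exactly the multiplicities given by $\mathcal A$. -/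

import Mathlib

/-!  Bag semantics for DL-Lite_core: ontologies, rooted conjunctive queries, bag certain answers,
and queries of the bag algebra BALG¹_ε.

The vocabulary consists of four types: individuals `Ind`, variables `Vars`, atomic concepts `Con`
and atomic roles `Rol`.  Repetition-free tuples `x` of variables are represented by finite sets of
variables, and a tuple of the same size as `x` over a set `M` by a function `x → M`. -/

universe u

namespace BagDL

/-! ### Bags -/

/-- A bag over `M`: a function to the nonnegative integers with infinity. -/
abbrev Bag (M : Type*) : Type _ := M → ℕ∞

/-- The (possibly infinite) sum of a family of multiplicities: the supremum of its finite partial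
sums. -/
noncomputable def bagSum {ι : Type*} (f : ι → ℕ∞) : ℕ∞ := ⨆ s : Finset ι, ∑ i ∈ s, f i

/-! ### Ontologies -/

/-- A role is an atomic role or its inverse. -/
inductive DLRole (Rol : Type) : Type
  | atomic (P : Rol)
  | inv (P : Rol)

/-- A concept is an atomic concept or `∃ R` for a role `R`. -/
inductive DLConcept (Con Rol : Type) : Type
  | atomic (A : Con)
  | ex (R : DLRole Rol)

/-- The axioms of DL-Lite_core: inclusions `C ⊑ D` and disjointness axioms `Disj(C, D)` between
concepts. -/
inductive DLAxiom (Con Rol : Type) : Type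
  | incl (C D : DLConcept Con Rol)
  | disj (C D : DLConcept Con Rol)

/-- A DL-Lite_core TBox is a finite set of axioms. -/
abbrev TBox (Con Rol : Type) : Type := Finset (DLAxiom Con Rol)

/-- Concept assertions `A(a)` and role assertions `P(a, b)`. -/
inductive Assertion (Ind Con Rol : Type) : Type
  | con (A : Con) (a : Ind)
  | rol (P : Rol) (a b : Ind)

/-- A bag ABox is a finite bag of assertions: all multiplicities are finite, and only finitely many
of them are nonzero. -/
abbrev BagABox (Ind Con Rol : Type) : Type := Assertion Ind Con Rol →₀ ℕ

/-- A bag interpretation (with unique names for individuals). -/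
structure BagInterp (Ind Con Rol : Type) : Type (u + 1) where
  /-- the domain -/
  Dom : Type u
  nonempty : Nonempty Dom
  /-- the interpretation of individuals -/
  ind : Ind → Dom
  ind_injective : Function.Injective ind
  /-- the interpretation of atomic concepts -/
  con : Con → Bag Dom
  /-- the interpretation of atomic roles -/
  rol : Rol → Bag (Dom × Dom)

namespace BagInterp

variable {Ind Con Rol : Type} (I : BagInterp.{u} Ind Con Rol)

/-- The interpretation of a role. -/
def role : DLRole Rol → Bag (I.Dom × I.Dom)
  | .atomic P => I.rol P
  | .inv P => fun p => I.rol P (p.2, p.1)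

/-- The interpretation of a concept. -/
noncomputable def concept : DLConcept Con Rol → Bag I.Dom
  | .atomic A => I.con A
  | .ex R => fun d => bagSum fun e => I.role R (d, e)

/-- Satisfaction of a TBox axiom: `⊆` and `∩` are those of bags (pointwise `≤` and pointwise
minimum), and `0` is the empty bag. -/
def SatAxiom : DLAxiom Con Rol → Prop
  | .incl C D => I.concept C ≤ I.concept D
  | .disj C D => I.concept C ⊓ I.concept D = 0

/-- Satisfaction of a TBox. -/
def SatTBox (T : TBox Con Rol) : Prop := ∀ α ∈ T, I.SatAxiom α

/-- Satisfaction of a bag ABox. -/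
def SatABox (𝒜 : BagABox Ind Con Rol) : Prop :=
  (∀ A a, (𝒜 (.con A a) : ℕ∞) ≤ I.con A (I.ind a)) ∧
    ∀ P a b, (𝒜 (.rol P a b) : ℕ∞) ≤ I.rol P (I.ind a, I.ind b)

/-- `I` is a bag model of the ontology `⟨T, 𝒜⟩`. -/
def IsModel (T : TBox Con Rol) (𝒜 : BagABox Ind Con Rol) : Prop := I.SatTBox T ∧ I.SatABox 𝒜

end BagInterp

/-- The ontology `⟨T, 𝒜⟩` is satisfiable: it has a bag model. -/
def Satisfiable {Ind Con Rol : Type} (T : TBox Con Rol) (𝒜 : BagABox Ind Con Rol) : Prop :=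
  ∃ I : BagInterp.{u} Ind Con Rol, I.IsModel T 𝒜

/-- A bag ABox seen as a bag interpretation, that is, its least bag model: the domain is the set of
individuals, each individual denotes itself, and the multiplicities are those of the ABox. -/
def aboxInterp {Ind Con Rol : Type} [Nonempty Ind] (𝒜 : BagABox Ind Con Rol) :
    BagInterp.{0} Ind Con Rol where
  Dom := Ind
  nonempty := inferInstance
  ind := id
  ind_injective := Function.injective_id
  con := fun A a => 𝒜 (.con A a)
  rol := fun P p => 𝒜 (.rol P p.1 p.2)

/-! ### Terms and atoms -/

/-- Terms over a set `V` of variables: variables and individuals. -/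
inductive Term (Ind V : Type) : Type
  | var (v : V)
  | ind (a : Ind)

/-- Atoms `A(t)` and `P(t₁, t₂)` (equalities are treated separately). -/
inductive Atom (Ind V Con Rol : Type) : Type
  | con (A : Con) (t : Term Ind V)
  | rol (P : Rol) (t₁ t₂ : Term Ind V)

namespace Atom

variable {Ind V Con Rol : Type}

/-- The term `s` is mentioned in the atom. -/
def Mentions (s : Term Ind V) : Atom Ind V Con Rol → Prop
  | .con _ t => s = t
  | .rol _ t₁ t₂ => s = t₁ ∨ s = t₂

end Atom

namespace BagInterp

variable {Ind Con Rol V : Type} (I : BagInterp.{u} Ind Con Rol)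

/-- The value of a term under an assignment of the variables; individuals have their fixed
interpretation. -/
def term (lam : V → I.Dom) : Term Ind V → I.Dom
  | .var v => lam v
  | .ind a => I.ind a

/-- The multiplicity of (the image of) an atom under an assignment. -/
def atom (lam : V → I.Dom) : Atom Ind V Con Rol → ℕ∞
  | .con A t => I.con A (I.term lam t)
  | .rol P t₁ t₂ => I.rol P (I.term lam t₁, I.term lam t₂)

end BagInterp

/-! ### Conjunctive queries -/

/-- The relation `∼` on terms: the equivalence relation generated by a list of equality atoms
`z = t`. -/
def termSetoid {Ind V : Type} (eqs : List (V × Term Ind V)) : Setoid (Term Ind V) :=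
  Relation.EqvGen.setoid fun s t => ∃ e ∈ eqs, s = .var e.1 ∧ t = e.2

/-- A (safe) conjunctive query `q(x) = ∃ y. φ(x, y)`.  The conjunction `φ` is nonempty; it consists
of a list of atoms over concepts and roles, in which repetitions matter, and a list of equality
atoms `z = t`.  By safety `φ` has an equality only if it has an atom over a concept or role, so
`φ` is nonempty iff `atoms` is. -/
structure CQ (Ind Vars Con Rol : Type) [DecidableEq Vars] : Type where
  /-- the answer variables `x` -/
  ans : Finset Vars
  /-- the existentially quantified variables `y` -/
  ex : Finset Vars
  disjoint : Disjoint ans ex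
  /-- the atoms of `φ` over concepts and roles -/
  atoms : List (Atom Ind {v // v ∈ ans ∪ ex} Con Rol)
  /-- the equality atoms of `φ` -/
  eqs : List ({v // v ∈ ans ∪ ex} × Term Ind {v // v ∈ ans ∪ ex})
  atoms_ne_nil : atoms ≠ []
  /-- safety: the class of every variable contains a term mentioned in an atom that is not an
  equality -/
  safe : ∀ v : {v // v ∈ ans ∪ ex}, ∃ t : Term Ind {v // v ∈ ans ∪ ex},
    (termSetoid eqs) (.var v) t ∧ ∃ α ∈ atoms, α.Mentions t

namespace CQ

variable {Ind Vars Con Rol : Type} [DecidableEq Vars] (q : CQ Ind Vars Con Rol)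

/-- The variables `x ∪ y` of the query. -/
abbrev V : Type := {v // v ∈ q.ans ∪ q.ex}

/-- The term `t` occurs in the conjunction of the query. -/
def Occurs (t : Term Ind q.V) : Prop :=
  (∃ α ∈ q.atoms, α.Mentions t) ∨ ∃ e ∈ q.eqs, t = .var e.1 ∨ t = e.2

/-- The equivalence classes of terms. -/
abbrev Node : Type := Quotient (termSetoid q.eqs)

/-- The Gaifman graph: the classes of two terms are adjacent if they are distinct and there is an
atom over the two terms.  (Classes of terms that do not occur in the query are isolated here; the
proper nodes are the classes of terms that occur.) -/
def gaifman : SimpleGraph q.Node :=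
  SimpleGraph.fromRel fun c d => ∃ P t₁ t₂, Atom.rol P t₁ t₂ ∈ q.atoms ∧
    c = Quotient.mk _ t₁ ∧ d = Quotient.mk _ t₂

/-- The term is an answer variable or an individual. -/
def IsRoot : Term Ind q.V → Prop
  | .var v => v.1 ∈ q.ans
  | .ind _ => True

/-- The query is rooted: every connected component of the Gaifman graph has a node that contains an
answer variable or an individual. -/
def Rooted : Prop :=
  ∀ t : Term Ind q.V, q.Occurs t →
    ∃ s : Term Ind q.V, q.IsRoot s ∧ q.gaifman.Reachable (Quotient.mk _ t) (Quotient.mk _ s)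

/-- The valuations of the query for an answer tuple `a`: they map `x` to the interpretation of `a`
and satisfy the equality atoms. -/
def Valuation (I : BagInterp.{u} Ind Con Rol) (a : {v // v ∈ q.ans} → Ind) : Type u :=
  {lam : q.V → I.Dom //
    (∀ (v : Vars) (h : v ∈ q.ans),
      lam ⟨v, Finset.mem_union_left _ h⟩ = I.ind (a ⟨v, h⟩)) ∧
    ∀ e ∈ q.eqs, lam e.1 = I.term lam e.2}

/-- The bag answers to the query over a bag interpretation. -/
noncomputable def answers (I : BagInterp.{u} Ind Con Rol) : Bag ({v // v ∈ q.ans} → Ind) :=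
  fun a => bagSum fun lam : q.Valuation I a => (q.atoms.map (I.atom lam.1)).prod

/-- The bag certain answers to the query over the ontology `⟨T, 𝒜⟩`: the intersection (pointwise
infimum) of the bag answers over all bag models with domain in `Type u`. -/
noncomputable def certain (T : TBox Con Rol) (𝒜 : BagABox Ind Con Rol) :
    Bag ({v // v ∈ q.ans} → Ind) :=
  ⨅ (I : BagInterp.{u} Ind Con Rol) (_ : I.IsModel T 𝒜), q.answers I

end CQ

/-! ### BALG¹_ε-queries -/

/-- The set of variables of a term: `{t} \ Ind`. -/
def Term.vars {Ind Vars : Type} {X : Finset Vars} : Term Ind {v // v ∈ X} → Finset Vars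
  | .var v => {v.1}
  | .ind _ => ∅

/-- The BALG¹_ε-queries with answer variables `X`. -/
inductive BALG (Ind Vars Con Rol : Type) [DecidableEq Vars] : Finset Vars → Type
  /-- an atom `S(t)` over `X` and the individuals that mentions all of `X` -/
  | atom {X : Finset Vars} (α : Atom Ind {v // v ∈ X} Con Rol)
      (h : ∀ v : {v // v ∈ X}, α.Mentions (.var v)) : BALG Ind Vars Con Rol X
  /-- `q₁(X₁) ∧ q₂(X₂)` -/
  | and {X X₁ X₂ : Finset Vars} (h : X = X₁ ∪ X₂)
      (q₁ : BALG Ind Vars Con Rol X₁) (q₂ : BALG Ind Vars Con Rol X₂) : BALG Ind Vars Con Rol X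
  /-- `q₀(X₀) ∧ (x = t)` -/
  | eq {X X₀ : Finset Vars} (q₀ : BALG Ind Vars Con Rol X₀) (x : {v // v ∈ X₀})
      (t : Term Ind {v // v ∈ X}) (h : X = X₀ ∪ t.vars) : BALG Ind Vars Con Rol X
  /-- `∃ Y. q₀(X, Y)` -/
  | ex {X Z : Finset Vars} (Y : Finset Vars) (hd : Disjoint X Y) (h : Z = X ∪ Y)
      (q₀ : BALG Ind Vars Con Rol Z) : BALG Ind Vars Con Rol X
  /-- max union `q₁(X) ∨ q₂(X)` -/
  | maxUnion {X : Finset Vars} (q₁ q₂ : BALG Ind Vars Con Rol X) : BALG Ind Vars Con Rol X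
  /-- arithmetic union `q₁(X) ⊎ q₂(X)` -/
  | arUnion {X : Finset Vars} (q₁ q₂ : BALG Ind Vars Con Rol X) : BALG Ind Vars Con Rol X
  /-- difference `q₁(X) \ q₂(X)` -/
  | diff {X : Finset Vars} (q₁ q₂ : BALG Ind Vars Con Rol X) : BALG Ind Vars Con Rol X

namespace BALG

variable {Ind Vars Con Rol : Type} [DecidableEq Vars]

open Classical in
/-- The multiplicity of a tuple `lam` of domain elements in the evaluation of a query.  The
difference of multiplicities is truncated, `max {0, m - n}`. -/
noncomputable def eval (I : BagInterp.{u} Ind Con Rol) : {X : Finset Vars} →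
    BALG Ind Vars Con Rol X → ({v // v ∈ X} → I.Dom) → ℕ∞
  | _, .atom α _, lam => I.atom lam α
  | _, .and h q₁ q₂, lam =>
      q₁.eval I (fun v => lam ⟨v.1, h ▸ Finset.mem_union_left _ v.2⟩) *
        q₂.eval I (fun v => lam ⟨v.1, h ▸ Finset.mem_union_right _ v.2⟩)
  | _, .eq q₀ x t h, lam =>
      if lam ⟨x.1, h ▸ Finset.mem_union_left _ x.2⟩ = I.term lam t then
        q₀.eval I (fun v => lam ⟨v.1, h ▸ Finset.mem_union_left _ v.2⟩)
      else 0
  | X, .ex Y _ h q₀, lam =>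
      bagSum fun lam' : {v // v ∈ Y} → I.Dom =>
        q₀.eval I (fun v =>
          if hX : v.1 ∈ X then lam ⟨v.1, hX⟩
          else lam' ⟨v.1, (Finset.mem_union.1 (h ▸ v.2)).resolve_left hX⟩)
  | _, .maxUnion q₁ q₂, lam => max (q₁.eval I lam) (q₂.eval I lam)
  | _, .arUnion q₁ q₂, lam => q₁.eval I lam + q₂.eval I lam
  | _, .diff q₁ q₂, lam => q₁.eval I lam - q₂.eval I lam

/-- The bag answers to a BALG¹_ε-query over a bag interpretation. -/
noncomputable def answers {X : Finset Vars} (q : BALG Ind Vars Con Rol X)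
    (I : BagInterp.{u} Ind Con Rol) : Bag ({v // v ∈ X} → Ind) :=
  fun a => q.eval I fun v => I.ind (a v)

end BALG

end BagDL

-- The certain answers to a rooted query are its answers over one canonical model, and that model is
-- regular enough for its matches to be counted by an algebra query over the ABox.
--
-- The model `canon` hangs trees of anonymous elements below the individuals. The TBox forces an
-- individual into ∃R with multiplicity `closure`, the maximum of its ABox multiplicities over the
-- concepts included in ∃R. The ABox edges cover part of it; the rest, `gap`, becomes that many
-- numbered R-successors. Deeper down all multiplicities are 0 or 1, so an anonymous element is
-- given by its individual, the copy number of its first edge and the word of roles leading to it.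
--
-- Universality (`canon_answers_le`): every model receives a map `hom` from `canon`. It need not be
-- injective, but around each element it is injective on the copies of edges of a given role,
-- because first anonymous edges are sent to copies outside the ABox (`exists_edges`). Count a match
-- together with a chosen copy for each atom. Such data map to data of the same kind in the model,
-- and injectively: matches agree at the roots, and in a rooted query everything else is reached
-- from there along edges.
--
-- Counting (`canon_answers`): group the matches by the words of the variables. Rootedness leaves
-- finitely many families of words (`finite_words`). With the words and the individuals above the
-- variables fixed, only copy numbers remain, and they contribute one factor `cap` for each class of
-- variables in a common copy. The count `body` is thus a product of equalities, ABox
-- multiplicities, closures and gaps. Max unions express closures, differences express gaps,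
-- projections sum over the individuals and arithmetic unions sum over the words.

universe v

namespace BagDL

/-! ### Sums of multiplicities and counting of copies -/

section

/-- The indicator of a proposition. -/
noncomputable def iv (p : Prop) : ℕ∞ := open Classical in if p then 1 else 0

@[simp] theorem iv_of {p : Prop} (h : p) : iv p = 1 := if_pos h

@[simp] theorem iv_of_not {p : Prop} (h : ¬p) : iv p = 0 := if_neg h

theorem iv_and (p q : Prop) : iv (p ∧ q) = iv p * iv q := by
  by_cases hp : p <;> by_cases hq : q <;> simp [hp, hq]

theorem iv_ne_zero {p : Prop} : iv p ≠ 0 ↔ p := by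
  by_cases hp : p <;> simp [hp]

theorem iv_congr {p q : Prop} (h : p ↔ q) : iv p = iv q := congrArg iv (propext h)

section BagSum

variable {ι κ : Type*}

/-- Every family of multiplicities is summable, which gives access to the `tsum` API. -/
theorem hasSum_bagSum (f : ι → ℕ∞) : HasSum f (bagSum f) :=
  hasSum_of_isLUB_of_nonneg _ (fun _ => bot_le) (isLUB_iSup (f := fun s : Finset ι => ∑ i ∈ s, f i))

theorem summable_enat (f : ι → ℕ∞) : Summable f := (hasSum_bagSum f).summable

theorem bagSum_eq_tsum (f : ι → ℕ∞) : bagSum f = ∑' i, f i := (hasSum_bagSum f).tsum_eq.symm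

theorem bagSum_equiv (e : ι ≃ κ) (f : κ → ℕ∞) : bagSum (fun i => f (e i)) = bagSum f := by
  simp only [bagSum_eq_tsum]
  exact e.tsum_eq f

theorem bagSum_of_injective {g : ι → κ} (hg : Function.Injective g) (f : κ → ℕ∞)
    (hf : ∀ k, f k ≠ 0 → k ∈ Set.range g) : bagSum f = bagSum fun i => f (g i) := by
  simp only [bagSum_eq_tsum]
  exact (hg.tsum_eq fun k hk => hf k hk).symm

theorem bagSum_subtype (p : ι → Prop) (f : ι → ℕ∞) :
    (bagSum fun i : {i // p i} => f i.1) = bagSum fun i => iv (p i) * f i := by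
  rw [bagSum_of_injective (Subtype.val_injective (p := p))]
  · congr 1; ext i; simp [i.2]
  · intro k hk
    by_contra h
    simp_all

theorem bagSum_single (i : ι) (f : ι → ℕ∞) (h : ∀ k, k ≠ i → f k = 0) : bagSum f = f i := by
  rw [bagSum_eq_tsum]; exact tsum_eq_single i h

theorem bagSum_eq_sum (s : Finset ι) (f : ι → ℕ∞) (h : ∀ k, k ∉ s → f k = 0) :
    bagSum f = ∑ i ∈ s, f i := by
  rw [bagSum_eq_tsum]; exact tsum_eq_sum fun k hk => h k hk

theorem bagSum_zero : bagSum (fun _ : ι => 0) = 0 := by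
  rw [bagSum_eq_tsum]; exact tsum_zero

theorem bagSum_add (f g : ι → ℕ∞) : bagSum (fun i => f i + g i) = bagSum f + bagSum g := by
  simp only [bagSum_eq_tsum]
  exact (summable_enat f).tsum_add (summable_enat g)

theorem bagSum_mul_left (c : ℕ∞) (f : ι → ℕ∞) : bagSum (fun i => c * f i) = c * bagSum f := by
  simp only [bagSum_eq_tsum]
  exact (summable_enat f).tsum_mul_left c

theorem bagSum_prod (f : ι × κ → ℕ∞) : bagSum f = bagSum fun i => bagSum fun k => f (i, k) := by
  simp only [bagSum_eq_tsum]
  exact (summable_enat f).tsum_prod' fun _ => summable_enat _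

theorem le_bagSum (f : ι → ℕ∞) (i : ι) : f i ≤ bagSum f := by
  rw [bagSum_eq_tsum]; exact (summable_enat f).le_tsum i fun _ _ => bot_le

theorem bagSum_ne_zero {f : ι → ℕ∞} (h : bagSum f ≠ 0) : ∃ i, f i ≠ 0 := by
  by_contra! h'
  exact h ((congrArg bagSum (funext h')).trans bagSum_zero)

/-- Sums of indicators count. -/
theorem bagSum_indicator (p : ι → Prop) :
    (bagSum fun i => iv (p i)) = {i | p i}.encard := by
  by_cases h : {i | p i}.Finite
  · rw [bagSum_eq_sum h.toFinset]
    · rw [h.encard_eq_coe_toFinset_card, Finset.sum_congr rfl (g := fun _ => 1)]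
      · simp
      · intro i hi; simp_all
    · intro k hk; simp_all
  · rw [Set.encard_eq_top_iff.2 h, ENat.eq_top_iff_forall_ge]
    intro n
    obtain ⟨t, ht, hn⟩ := Set.Infinite.exists_subset_card_eq h n
    refine le_trans ?_ (le_iSup _ t)
    rw [Finset.sum_congr rfl (g := fun _ => 1)]
    · simp [hn]
    · intro i hi; exact iv_of (ht hi)

/-- Reads a multiplicity as the number of its copies 0, 1, …, so that sums of products become
cardinalities and can be compared by injections. -/
theorem bagSum_lt (n : ℕ∞) : (bagSum fun k : ℕ => iv ((k : ℕ∞) < n)) = n := by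
  rw [bagSum_indicator]
  induction n using ENat.recTopCoe with
  | top => simp
  | coe n =>
    have : {i : ℕ | (i : ℕ∞) < n} = (Finset.range n : Set ℕ) := by ext; simp
    rw [this, Set.encard_coe_eq_coe_finsetCard]; simp

theorem bagSum_fin_lt (n : ℕ) (c : Fin n → ℕ∞) :
    (bagSum fun k : Fin n → ℕ => iv (∀ x, (k x : ℕ∞) < c x)) = ∏ x, c x := by
  induction n with
  | zero =>
    rw [bagSum_single (fun x => x.elim0) _ fun k hk => (hk (Subsingleton.elim _ _)).elim]
    simp
  | succ n ih =>
    rw [← bagSum_equiv (Fin.consEquiv fun _ => ℕ), bagSum_prod, Fin.prod_univ_succ,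
      ← bagSum_lt (c 0), mul_comm, ← bagSum_mul_left]
    congr 1; ext k
    rw [← ih fun x => c x.succ, mul_comm, ← bagSum_mul_left]
    congr 1; ext l
    by_cases h : (k : ℕ∞) < c 0 <;> simp [Fin.consEquiv, Fin.forall_fin_succ, h]

theorem bagSum_pi_lt [Fintype κ] (c : κ → ℕ∞) :
    (bagSum fun k : κ → ℕ => iv (∀ x, (k x : ℕ∞) < c x)) = ∏ x, c x := by
  have e := Fintype.equivFin κ
  rw [← e.symm.prod_comp, ← bagSum_fin_lt, ← bagSum_equiv (e.symm.arrowCongr (Equiv.refl ℕ))]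
  congr 1; ext k
  congr 1
  simpa using e.forall_congr (by simp)

/-- A comparison of sums of products by an injection between the bags they count. -/
theorem bagSum_prod_le {ι' : Type*} [Fintype κ] (f : ι → κ → ℕ∞) (g : ι' → κ → ℕ∞)
    (m : ι → ι') (l : ι → κ → ℕ → ℕ)
    (hl : ∀ i x (k : ℕ), (k : ℕ∞) < f i x → (l i x k : ℕ∞) < g (m i) x)
    (inj : ∀ i i' (k k' : κ → ℕ), (∀ x, (k x : ℕ∞) < f i x) → (∀ x, (k' x : ℕ∞) < f i' x) →
      m i = m i' → (∀ x, l i x (k x) = l i' x (k' x)) → i = i' ∧ k = k') :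
    (bagSum fun i => ∏ x, f i x) ≤ bagSum fun i => ∏ x, g i x := by
  -- A product counts the choices of one copy per factor; both sides become cardinalities of sets of
  -- pairs of an index and a choice.
  simp only [← bagSum_pi_lt]
  rw [← bagSum_prod fun p : ι × (κ → ℕ) => iv (∀ x, (p.2 x : ℕ∞) < f p.1 x),
    ← bagSum_prod fun p : ι' × (κ → ℕ) => iv (∀ x, (p.2 x : ℕ∞) < g p.1 x),
    bagSum_indicator, bagSum_indicator]
  refine Set.encard_le_encard_of_injOn (f := fun p => (m p.1, fun x => l p.1 x (p.2 x))) ?_ ?_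
  · rintro ⟨i, k⟩ hk x
    exact hl i x _ (hk x)
  · rintro ⟨i, k⟩ hk ⟨i', k'⟩ hk' h
    obtain ⟨rfl, rfl⟩ := inj i i' k k' hk hk' (congrArg Prod.fst h)
      fun x => congrFun (congrArg Prod.snd h) x
    rfl

/-- If `c` is constant on the classes of `s`, the product over the classes counts the
functions below `c` that are constant on the classes of `s`. -/
theorem bagSum_classes (s : Setoid κ) [Fintype (Quotient s)] (c : κ → ℕ∞)
    (hc : ∀ x y, s x y → c x = c y) :
    (bagSum fun k : κ → ℕ => iv ((∀ x y, s x y → k x = k y) ∧ ∀ x, (k x : ℕ∞) < c x))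
      = ∏ x : Quotient s, c x.out := by
  have hinj : Function.Injective fun (k : Quotient s → ℕ) (x : κ) => k (Quotient.mk s x) := by
    intro k k' h
    ext x
    obtain ⟨x, rfl⟩ := Quotient.exists_rep x
    exact congrFun h x
  rw [bagSum_of_injective hinj, ← bagSum_pi_lt]
  · congr 1; ext k
    congr 1
    rw [eq_iff_iff]
    constructor
    · rintro ⟨-, h⟩ x
      simpa using h x.out
    · intro h
      refine ⟨fun x y hxy => congrArg k (Quotient.sound hxy), fun x => ?_⟩
      rw [hc x _ (s.symm (Quotient.mk_out x))]
      exact h _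
  · intro k hk
    have hk' : ∀ x y, s x y → k x = k y := by
      by_contra h
      simp [h] at hk
    exact ⟨Quotient.lift k hk', rfl⟩

end BagSum

end

/-! ### The canonical model -/

section

variable {Ind Con Rol : Type}

namespace DLRole

/-- The inverse of a role. -/
def swap : DLRole Rol → DLRole Rol
  | .atomic P => .inv P
  | .inv P => .atomic P

@[simp] theorem swap_swap (R : DLRole Rol) : R.swap.swap = R := by cases R <;> rfl

end DLRole

theorem BagInterp.role_swap (I : BagInterp.{u} Ind Con Rol) (R : DLRole Rol) (d e : I.Dom) :
    I.role R.swap (d, e) = I.role R (e, d) := by cases R <;> rfl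

/-- Entailment of concept inclusions by the inclusion axioms of a TBox. -/
def TBox.Sub (T : TBox Con Rol) : DLConcept Con Rol → DLConcept Con Rol → Prop :=
  Relation.ReflTransGen fun C D => DLAxiom.incl C D ∈ T

theorem BagInterp.SatTBox.concept_le {I : BagInterp.{u} Ind Con Rol} {T : TBox Con Rol}
    (h : I.SatTBox T) {C D : DLConcept Con Rol} (hCD : T.Sub C D) :
    I.concept C ≤ I.concept D := by
  induction hCD with
  | refl => exact le_rfl
  | tail _ hm ih => exact ih.trans (h _ hm)

/-- Apart from D itself, only left-hand sides of axioms occur. This turns the supremum in `closure`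
into a finite maximum. -/
theorem TBox.finite_sub (T : TBox Con Rol) (D : DLConcept Con Rol) :
    {C | T.Sub C D}.Finite := by
  let g : DLAxiom Con Rol → DLConcept Con Rol := fun α =>
    match α with
    | .incl C _ => C
    | .disj C _ => C
  refine ((T.finite_toSet.image g).insert D).subset fun C hC => ?_
  rcases Relation.ReflTransGen.cases_head hC with rfl | ⟨E, hE, -⟩
  · exact Set.mem_insert _ _
  · exact Set.mem_insert_of_mem _ ⟨_, hE, rfl⟩

/-- The elements of the canonical model: `⟨a, 0, []⟩` is the individual `a`, and `⟨a, j, w⟩` is an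
anonymous element reached from `a` by the word `w` (read backwards) in the `j`-th copy. -/
structure Elem (Ind Rol : Type) : Type u where
  /-- the individual above the element -/
  root : Ind
  /-- the number of the copy -/
  idx : ℕ
  /-- the word leading to the element, backwards -/
  word : List (DLRole Rol)

namespace Elem

/-- `e` is obtained from `d` by an edge for `R`. -/
def Child (R : DLRole Rol) (d e : Elem.{u} Ind Rol) : Prop :=
  d.root = e.root ∧ e.word = R :: d.word ∧ (d.word ≠ [] → d.idx = e.idx)

/-- The parent of an anonymous element. -/
def parent (d : Elem.{u} Ind Rol) : Elem.{u} Ind Rol :=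
  match d.word.tail with
  | [] => ⟨d.root, 0, []⟩
  | w => ⟨d.root, d.idx, w⟩

theorem child_parent {a : Ind} {j : ℕ} (R : DLRole Rol) (w : List (DLRole Rol)) :
    Child R (parent (⟨a, j, R :: w⟩ : Elem.{u} Ind Rol)) ⟨a, j, R :: w⟩ := by
  cases w <;> simp [parent, Child]

end Elem

section Canonical

variable [Nonempty Ind] (T : TBox Con Rol) (𝒜 : BagABox Ind Con Rol)

/-- The multiplicity with which an individual belongs to a concept according to the ontology. -/
noncomputable def closure (C : DLConcept Con Rol) (a : Ind) : ℕ∞ :=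
  ⨆ (C₀) (_ : T.Sub C₀ C), (aboxInterp 𝒜).concept C₀ a

/-- The interpretation of roles in an ABox. -/
noncomputable def aboxRole (R : DLRole Rol) (a b : Ind) : ℕ∞ := (aboxInterp 𝒜).role R (a, b)

theorem aboxRole_swap (R : DLRole Rol) (a b : Ind) :
    aboxRole 𝒜 R.swap a b = aboxRole 𝒜 R b a :=
  (aboxInterp 𝒜).role_swap R a b

theorem le_closure (C : DLConcept Con Rol) (a : Ind) :
    (aboxInterp 𝒜).concept C a ≤ closure T 𝒜 C a :=
  le_iSup₂_of_le C .refl le_rfl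

theorem closure_mono {C D : DLConcept Con Rol} (h : T.Sub C D) (a : Ind) :
    closure T 𝒜 C a ≤ closure T 𝒜 D a :=
  iSup₂_le fun C₀ h₀ => le_iSup₂_of_le C₀ (h₀.trans h) le_rfl

/-- The number of anonymous `R`-successors that an individual needs. -/
noncomputable def gap (R : DLRole Rol) (a : Ind) : ℕ∞ :=
  closure T 𝒜 (.ex R) a - (aboxInterp 𝒜).concept (.ex R) a

theorem concept_add_gap (R : DLRole Rol) (a : Ind) :
    (aboxInterp 𝒜).concept (.ex R) a + gap T 𝒜 R a = closure T 𝒜 (.ex R) a :=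
  add_tsub_cancel_of_le (le_closure T 𝒜 _ a)

/-- The number of copies of a word of roles below an individual; the last role of the word is that
of the edge at the individual. -/
noncomputable def cap (a : Ind) : List (DLRole Rol) → ℕ∞
  | [] => 1
  | [R] => gap T 𝒜 R a
  | _ :: S :: w => cap a (S :: w)

/-- The words of roles along the paths of anonymous elements. -/
def Chain (w : List (DLRole Rol)) : Prop :=
  w.IsChain fun R S => T.Sub (.ex S.swap) (.ex R) ∧ R ≠ S.swap

namespace Elem

/-- The elements that are needed in the canonical model. -/
def Valid (d : Elem.{u} Ind Rol) : Prop :=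
  (d.idx : ℕ∞) < cap T 𝒜 d.root d.word ∧ Chain T d.word

/-- The multiplicity of a needed element in a concept. -/
noncomputable def tp (C : DLConcept Con Rol) (d : Elem.{u} Ind Rol) : ℕ∞ :=
  match d.word with
  | [] => closure T 𝒜 C d.root
  | R :: _ => iv (T.Sub (.ex R.swap) C)

/-- The multiplicity of a pair of needed elements in a role. -/
noncomputable def edge (R : DLRole Rol) (d e : Elem.{u} Ind Rol) : ℕ∞ :=
  open Classical in
  if d.word = [] ∧ e.word = [] then aboxRole 𝒜 R d.root e.root
  else iv (Child R d e ∨ Child R.swap e d)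

theorem edge_swap (R : DLRole Rol) (d e : Elem.{u} Ind Rol) :
    edge 𝒜 R.swap d e = edge 𝒜 R e d := by
  unfold edge
  rw [aboxRole_swap, DLRole.swap_swap]
  simp only [and_comm, or_comm]

/-- The value 1 of `cap` at the empty word leaves each individual a single copy, numbered 0. -/
theorem valid_of_word_eq_nil {d : Elem.{u} Ind Rol} (h : d.word = []) :
    d.Valid T 𝒜 ↔ d.idx = 0 := by
  simp [Valid, h, cap, Chain]

end Elem

open Elem

/-- The canonical model. -/
noncomputable def canon : BagInterp.{u} Ind Con Rol where
  Dom := Elem.{u} Ind Rol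
  nonempty := ⟨⟨Classical.arbitrary Ind, 0, []⟩⟩
  ind a := ⟨a, 0, []⟩
  ind_injective _ _ h := congrArg Elem.root h
  con A d := iv (d.Valid T 𝒜) * d.tp T 𝒜 (.atomic A)
  rol P p := iv (p.1.Valid T 𝒜 ∧ p.2.Valid T 𝒜) * edge 𝒜 (.atomic P) p.1 p.2

theorem canon_role (R : DLRole Rol) (d e : Elem.{u} Ind Rol) :
    (canon T 𝒜).role R (d, e) = iv (d.Valid T 𝒜 ∧ e.Valid T 𝒜) * edge 𝒜 R d e := by
  cases R with
  | atomic P => rfl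
  | inv P =>
    change iv _ * edge 𝒜 _ _ _ = _
    rw [and_comm, ← edge_swap]
    rfl

theorem edge_of_ne_nil {R : DLRole Rol} {d e : Elem.{u} Ind Rol}
    (h : d.word ≠ [] ∨ e.word ≠ []) :
    edge 𝒜 R d e = iv (Child R d e ∨ Child R.swap e d) := by
  unfold edge
  rw [if_neg]
  tauto

theorem chain_cons {R S : DLRole Rol} {w : List (DLRole Rol)} :
    Chain T (R :: S :: w) ↔ (T.Sub (.ex S.swap) (.ex R) ∧ R ≠ S.swap) ∧ Chain T (S :: w) :=
  List.isChain_cons_cons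

theorem cap_tail {R : DLRole Rol} {w : List (DLRole Rol)} (hw : w ≠ []) (a : Ind) :
    cap T 𝒜 a (R :: w) = cap T 𝒜 a w := by
  cases w with
  | nil => exact (hw rfl).elim
  | cons S w => rfl

/-- The successors split into individuals, which contribute the ABox multiplicity of ∃R, and the
copies of the one-letter word `[R]`, which contribute `gap`. -/
theorem canon_concept_ex_nil {d : Elem.{u} Ind Rol} (R : DLRole Rol) (hd : d.Valid T 𝒜)
    (hw : d.word = []) : (canon T 𝒜).concept (.ex R) d = closure T 𝒜 (.ex R) d.root := by
  obtain ⟨a, j, w⟩ := d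
  obtain rfl : w = [] := hw
  obtain rfl : j = 0 := (valid_of_word_eq_nil T 𝒜 rfl).1 hd
  have hsplit : ∀ e : Elem.{u} Ind Rol, (canon T 𝒜).role R (⟨a, 0, []⟩, e) =
      iv (e.idx = 0 ∧ e.word = []) * aboxRole 𝒜 R a e.root +
      iv (e.root = a ∧ e.word = [R]) * iv ((e.idx : ℕ∞) < gap T 𝒜 R a) := by
    rintro ⟨b, j, w⟩
    rw [canon_role]
    rcases w with _ | ⟨S, w⟩
    · have h : Valid T 𝒜 (⟨b, j, []⟩ : Elem.{u} Ind Rol) ↔ j = 0 := valid_of_word_eq_nil T 𝒜 rfl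
      simp [edge, hd, h]
    · rw [edge_of_ne_nil _ (by simp), ← iv_and]
      simp only [reduceCtorEq, and_false, not_false_eq_true, iv_of_not, zero_mul, zero_add]
      rw [← iv_and]
      refine iv_congr ⟨?_, ?_⟩
      · rintro ⟨⟨-, h, -⟩, ⟨h₁, h₂, -⟩ | ⟨-, h₂, -⟩⟩
        · obtain rfl : a = b := h₁
          obtain ⟨rfl, rfl⟩ : S = R ∧ w = [] := by simpa using h₂
          exact ⟨⟨rfl, rfl⟩, h⟩
        · simp at h₂
      · rintro ⟨⟨h₁, h₂⟩, h₃⟩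
        obtain rfl : b = a := h₁
        obtain ⟨rfl, rfl⟩ : S = R ∧ w = [] := by simpa using h₂
        exact ⟨⟨hd, h₃, List.isChain_singleton _⟩, Or.inl ⟨rfl, rfl, by simp⟩⟩
  change bagSum (fun e : Elem.{u} Ind Rol => (canon T 𝒜).role R (⟨a, 0, []⟩, e)) = _
  simp only [hsplit]
  rw [bagSum_add, ← concept_add_gap]
  congr 1
  · rw [bagSum_of_injective (g := fun b : Ind => (⟨b, 0, []⟩ : Elem.{u} Ind Rol))]
    · simp [BagInterp.concept]; rfl
    · exact fun b c h => congrArg Elem.root h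
    · rintro ⟨b, j, w⟩ h
      have := iv_ne_zero.1 (left_ne_zero_of_mul h)
      exact ⟨b, by simp_all⟩
  · rw [bagSum_of_injective (g := fun j : ℕ => (⟨a, j, [R]⟩ : Elem.{u} Ind Rol))]
    · simp [bagSum_lt]
    · exact fun b c h => congrArg Elem.idx h
    · rintro ⟨b, j, w⟩ h
      have := iv_ne_zero.1 (left_ne_zero_of_mul h)
      exact ⟨j, by simp_all⟩

/-- Only the edge at the individual bounds the copy number; a further letter adds nothing but the
chain condition. -/
theorem valid_parent {a : Ind} {j : ℕ} {R S : DLRole Rol} {w : List (DLRole Rol)} :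
    (⟨a, j, R :: S :: w⟩ : Elem.{u} Ind Rol).Valid T 𝒜 ↔
      (T.Sub (.ex S.swap) (.ex R) ∧ R ≠ S.swap) ∧
        (⟨a, j, S :: w⟩ : Elem.{u} Ind Rol).Valid T 𝒜 := by
  simp only [Valid, chain_cons, cap]
  tauto

theorem valid_parent_self {d : Elem.{u} Ind Rol} (hd : d.Valid T 𝒜) : (parent d).Valid T 𝒜 := by
  rcases d with ⟨a, j, _ | ⟨R, _ | ⟨S, w⟩⟩⟩
  · exact (valid_of_word_eq_nil T 𝒜 rfl).2 rfl
  · exact (valid_of_word_eq_nil T 𝒜 rfl).2 rfl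
  · exact ((valid_parent T 𝒜).1 hd).2

/-- `Child` leaves the copy number of an element with empty word free; validity forces it to be 0.
-/
theorem eq_parent_of_child {R : DLRole Rol} {d e : Elem.{u} Ind Rol} (hd : d.Valid T 𝒜)
    (h : Child R d e) : d = parent e := by
  obtain ⟨a, j, w⟩ := d
  obtain ⟨b, k, v⟩ := e
  obtain ⟨rfl, rfl, h⟩ := h
  cases w with
  | nil => obtain rfl : j = 0 := (valid_of_word_eq_nil T 𝒜 rfl).1 hd; rfl
  | cons S w => obtain rfl : j = k := h (by simp); rfl

/-- The only possible neighbour of an anonymous element for a given role. -/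
noncomputable def neighbour (R S : DLRole Rol) (d : Elem.{u} Ind Rol) : Elem.{u} Ind Rol :=
  open Classical in if R = S.swap then parent d else ⟨d.root, d.idx, R :: d.word⟩

/-- An element entered by an S-edge has its parent as successor for the inverse of S, and the chain
condition forbids a child for that role. Any other entailed role has exactly one child, so each role
has at most one neighbour. -/
theorem canon_role_cons (a : Ind) (j : ℕ) (R S : DLRole Rol) (w : List (DLRole Rol))
    (hd : (⟨a, j, S :: w⟩ : Elem.{u} Ind Rol).Valid T 𝒜) (e : Elem.{u} Ind Rol) :
    (canon T 𝒜).role R (⟨a, j, S :: w⟩, e) =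
      iv (e = neighbour R S ⟨a, j, S :: w⟩ ∧ T.Sub (.ex S.swap) (.ex R)) := by
  rw [canon_role, edge_of_ne_nil _ (by simp), ← iv_and]
  refine iv_congr ⟨?_, ?_⟩
  · rintro ⟨⟨-, he⟩, h | h⟩
    · obtain ⟨b, k, v⟩ := e
      obtain ⟨rfl, rfl, h⟩ := h
      obtain rfl : j = k := h (by simp)
      obtain ⟨⟨h₁, h₂⟩, -⟩ := (valid_parent T 𝒜).1 he
      exact ⟨by simp [neighbour, h₂], h₁⟩
    · have h' := eq_parent_of_child T 𝒜 he h
      obtain ⟨-, h, -⟩ := h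
      obtain ⟨rfl, -⟩ : S = R.swap ∧ w = e.word := by simpa using h
      exact ⟨by simpa [neighbour] using h', by simpa using .refl⟩
  · rintro ⟨rfl, h⟩
    by_cases hRS : R = S.swap
    · subst hRS
      simp only [neighbour, if_true, DLRole.swap_swap]
      exact ⟨⟨hd, valid_parent_self T 𝒜 hd⟩, Or.inr (child_parent S w)⟩
    · simp only [neighbour, hRS, if_false]
      exact ⟨⟨hd, (valid_parent T 𝒜).2 ⟨⟨h, hRS⟩, hd⟩⟩, Or.inl ⟨rfl, rfl, fun _ => rfl⟩⟩

/-- The edges realise exactly the prescribed types, so inclusion axioms reduce to the monotonicity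
of `tp`. -/
theorem canon_concept (C : DLConcept Con Rol) (d : Elem.{u} Ind Rol) :
    (canon T 𝒜).concept C d = iv (d.Valid T 𝒜) * d.tp T 𝒜 C := by
  cases C with
  | atomic A => rfl
  | ex R =>
    by_cases hd : d.Valid T 𝒜
    · rw [iv_of hd, one_mul]
      by_cases hw : d.word = []
      · rw [canon_concept_ex_nil T 𝒜 R hd hw, tp, hw]
      · obtain ⟨a, j, _ | ⟨S, w⟩⟩ := d
        · exact (hw rfl).elim
        · change bagSum (fun e : Elem.{u} Ind Rol => (canon T 𝒜).role R (⟨a, j, S :: w⟩, e)) = _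
          simp only [canon_role_cons T 𝒜 a j R S w hd]
          rw [bagSum_single (neighbour R S ⟨a, j, S :: w⟩)]
          · simp [tp]
          · intro k hk
            simp [hk]
    · change bagSum (fun e : Elem.{u} Ind Rol => (canon T 𝒜).role R (d, e)) = _
      simp [canon_role, hd, bagSum_zero]

theorem tp_mono {C D : DLConcept Con Rol} (h : T.Sub C D) (d : Elem.{u} Ind Rol) :
    d.tp T 𝒜 C ≤ d.tp T 𝒜 D := by
  obtain ⟨a, j, _ | ⟨S, w⟩⟩ := d
  · exact closure_mono T 𝒜 h a
  · simp only [tp]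
    by_cases hC : T.Sub (.ex S.swap) C
    · rw [iv_of hC, iv_of (show T.Sub _ D from hC.trans h)]
    · simp [hC]

theorem canon_satABox : (canon.{u} T 𝒜).SatABox 𝒜 := by
  have hv : ∀ a, (⟨a, 0, []⟩ : Elem.{u} Ind Rol).Valid T 𝒜 :=
    fun a => (valid_of_word_eq_nil T 𝒜 rfl).2 rfl
  refine ⟨fun A a => ?_, fun P a b => ?_⟩
  · change _ ≤ iv (Valid T 𝒜 (⟨a, 0, []⟩ : Elem.{u} Ind Rol)) * closure T 𝒜 _ a
    rw [iv_of (hv a), one_mul]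
    exact le_closure T 𝒜 (.atomic A) a
  · change _ ≤ iv (Valid T 𝒜 (⟨a, 0, []⟩ : Elem.{u} Ind Rol) ∧
      Valid T 𝒜 (⟨b, 0, []⟩ : Elem.{u} Ind Rol)) *
        edge 𝒜 _ (⟨a, 0, []⟩ : Elem.{u} Ind Rol) (⟨b, 0, []⟩ : Elem.{u} Ind Rol)
    rw [iv_of ⟨hv a, hv b⟩, one_mul, edge, if_pos ⟨rfl, rfl⟩]
    exact le_rfl

end Canonical

end

/-! ### Rooted queries and comparison of the ABox with a model -/

section

variable {Ind Con Rol : Type}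

section Queries

variable {Vars : Type} [DecidableEq Vars] {q : CQ Ind Vars Con Rol}

/-- Induction along the Gaifman graph of a rooted query. -/
theorem CQ.Rooted.induction (hq : q.Rooted) {p : q.Node → Prop}
    (root : ∀ s, q.IsRoot s → p (Quotient.mk _ s))
    (step : ∀ P t₁ t₂, Atom.rol P t₁ t₂ ∈ q.atoms →
      (p (Quotient.mk _ t₁) ↔ p (Quotient.mk _ t₂))) (v : q.V) :
    p (Quotient.mk _ (.var v)) := by
  -- Rootedness concerns occurring terms only; safety provides one in the class of the variable.
  obtain ⟨t, ht, α, hα, hm⟩ := q.safe v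
  obtain ⟨s, hs, hr⟩ := hq t (Or.inl ⟨α, hα, hm⟩)
  rw [Quotient.sound ht]
  obtain ⟨w⟩ := hr
  have key : ∀ {c d : q.Node} (_ : q.gaifman.Walk c d), p d → p c := by
    intro c d w hd
    induction w with
    | nil => exact hd
    | cons hadj _ ih =>
      obtain ⟨-, ⟨P, t₁, t₂, h, rfl, rfl⟩ | ⟨P, t₁, t₂, h, rfl, rfl⟩⟩ := hadj
      · exact (step P t₁ t₂ h).2 (ih hd)
      · exact (step P t₁ t₂ h).1 (ih hd)
  exact key w (root s hs)

/-- The value of a function on terms that respects the equality atoms is constant on classes. -/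
theorem eq_of_termSetoid {Ind V : Type} {M : Type*} {eqs : List (V × Term Ind V)}
    {f : Term Ind V → M} (hf : ∀ e ∈ eqs, f (.var e.1) = f e.2) {s t : Term Ind V}
    (h : termSetoid eqs s t) : f s = f t := by
  induction h with
  | rel s t h => obtain ⟨e, he, rfl, rfl⟩ := h; exact hf e he
  | refl => rfl
  | symm _ _ _ ih => exact ih.symm
  | trans _ _ _ _ _ ih₁ ih₂ => exact ih₁.trans ih₂

end Queries

variable [Nonempty Ind]

open Elem

/-- Finiteness of the ABox is needed here in order to cancel this multiplicity in `exists_edges`. -/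
theorem aboxInterp_concept_ne_top (𝒜 : BagABox Ind Con Rol) (R : DLRole Rol) (a : Ind) :
    (aboxInterp 𝒜).concept (.ex R) a ≠ ⊤ := by
  classical
  let f : Assertion Ind Con Rol → Ind := fun
    | .con _ a => a
    | .rol _ a _ => a
  let g : Assertion Ind Con Rol → Ind := fun
    | .con _ a => a
    | .rol _ _ b => b
  have h : ∀ b, b ∉ 𝒜.support.image f ∪ 𝒜.support.image g → aboxRole 𝒜 R a b = 0 := by
    intro b hb
    simp only [Finset.mem_union, Finset.mem_image, Finsupp.mem_support_iff, not_or, not_exists,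
      not_and] at hb
    cases R with
    | atomic P =>
      change ((𝒜 (.rol P a b) : ℕ) : ℕ∞) = 0
      have := hb.2 (.rol P a b)
      simp_all [g]
    | inv P =>
      change ((𝒜 (.rol P b a) : ℕ) : ℕ∞) = 0
      have := hb.1 (.rol P b a)
      simp_all [f]
  change bagSum (fun b => aboxRole 𝒜 R a b) ≠ ⊤
  rw [bagSum_eq_sum _ _ h]
  refine (WithTop.sum_lt_top.2 fun b _ => ?_).ne
  cases R <;> exact ENat.natCast_lt_top _

namespace BagInterp

variable {I : BagInterp.{v} Ind Con Rol} {T : TBox Con Rol} {𝒜 : BagABox Ind Con Rol}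

theorem SatABox.aboxRole_le (h : I.SatABox 𝒜) (R : DLRole Rol) (a b : Ind) :
    aboxRole 𝒜 R a b ≤ I.role R (I.ind a, I.ind b) := by
  cases R with
  | atomic P => exact h.2 P a b
  | inv P => exact h.2 P b a

/-- For ∃R, unique names make a finite sum over individuals a partial sum over the domain. -/
theorem SatABox.concept_le (h : I.SatABox 𝒜) (C : DLConcept Con Rol) (a : Ind) :
    (aboxInterp 𝒜).concept C a ≤ I.concept C (I.ind a) := by
  cases C with
  | atomic A => exact h.1 A a
  | ex R =>
    refine iSup_le fun s => ?_
    refine le_trans ?_ (le_iSup _ (s.map ⟨I.ind, I.ind_injective⟩))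
    refine le_of_le_of_eq ?_ (Finset.sum_map _ _ _).symm
    exact Finset.sum_le_sum fun b _ => h.aboxRole_le R a b

theorem IsModel.closure_le (h : I.IsModel T 𝒜) (C : DLConcept Con Rol) (a : Ind) :
    closure T 𝒜 C a ≤ I.concept C (I.ind a) :=
  iSup₂_le fun C₀ hC => (h.2.concept_le C₀ a).trans (h.1.concept_le hC _)

/-- The anonymous successors of an individual can be mapped injectively to edges of a model that
are not among those of the ABox. -/
theorem IsModel.exists_edges (h : I.IsModel T 𝒜) (R : DLRole Rol) (a : Ind) :
    ∃ φ : ℕ → I.Dom × ℕ,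
      (∀ j : ℕ, (j : ℕ∞) < gap T 𝒜 R a → ((φ j).2 : ℕ∞) < I.role R (I.ind a, (φ j).1) ∧
        ∀ b, (φ j).1 = I.ind b → aboxRole 𝒜 R a b ≤ (φ j).2) ∧
      Set.InjOn φ {j | (j : ℕ∞) < gap T 𝒜 R a} := by
  obtain ⟨d⟩ := I.nonempty
  -- `S` consists of the copies of R-edges at the individual in the model, `S₀` of those already
  -- accounted for by the ABox.
  set S : Set (I.Dom × ℕ) := {p | (p.2 : ℕ∞) < I.role R (I.ind a, p.1)}
  set S₀ : Set (I.Dom × ℕ) :=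
    (fun p : Ind × ℕ => (I.ind p.1, p.2)) '' {p | (p.2 : ℕ∞) < aboxRole 𝒜 R a p.1}
  have hS : S.encard = I.concept (.ex R) (I.ind a) := by
    simp only [S]
    rw [← bagSum_indicator, bagSum_prod]
    simp only [bagSum_lt]
    rfl
  have hS₀ : S₀.encard = (aboxInterp 𝒜).concept (.ex R) a := by
    simp only [S₀]
    rw [Function.Injective.encard_image, ← bagSum_indicator, bagSum_prod]
    · simp only [bagSum_lt]
      rfl
    · rintro ⟨b, j⟩ ⟨c, k⟩ hbc
      simp only [Prod.mk.injEq] at hbc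
      rw [I.ind_injective hbc.1, hbc.2]
  have hsub : S₀ ⊆ S := by
    rintro _ ⟨⟨b, j⟩, hj, rfl⟩
    exact lt_of_lt_of_le hj (h.2.aboxRole_le R a b)
  have hle : gap T 𝒜 R a ≤ (S \ S₀).encard := by
    have h₁ := h.closure_le (.ex R) a
    rw [← concept_add_gap, ← hS, ← Set.encard_sdiff_add_encard_of_subset hsub, hS₀, add_comm] at h₁
    exact (WithTop.add_le_add_iff_right (aboxInterp_concept_ne_top 𝒜 R a)).1 h₁
  have key : ∃ φ : ℕ → I.Dom × ℕ, (∀ j : ℕ, (j : ℕ∞) < gap T 𝒜 R a → φ j ∈ S \ S₀) ∧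
      Set.InjOn φ {j | (j : ℕ∞) < gap T 𝒜 R a} := by
    -- For an infinite gap, the infinite set of spare copies contains an injective sequence.
    by_cases hg : {j : ℕ | (j : ℕ∞) < gap T 𝒜 R a}.Finite
    · have : Nonempty (I.Dom × ℕ) := ⟨(d, 0)⟩
      obtain ⟨φ, h₁, h₂⟩ := hg.exists_injOn_of_encard_le (t := S \ S₀) (by
        rwa [← bagSum_indicator, bagSum_lt])
      exact ⟨φ, fun j hj => h₁ hj, h₂⟩
    · have hinf : (S \ S₀).Infinite := by
        rw [← Set.encard_eq_top_iff, ← top_le_iff]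
        refine le_trans ?_ hle
        rw [← bagSum_lt (gap T 𝒜 R a), bagSum_indicator, Set.encard_eq_top_iff.2 hg]
      exact ⟨fun j => hinf.natEmbedding _ j, fun j _ => (hinf.natEmbedding _ j).2,
        fun j _ k _ hjk => (hinf.natEmbedding _).injective (Subtype.ext hjk)⟩
  obtain ⟨φ, h₁, h₂⟩ := key
  refine ⟨φ, fun j hj => ⟨(h₁ j hj).1, fun b hb => ?_⟩, h₂⟩
  by_contra! hlt
  exact (h₁ j hj).2 ⟨(b, (φ j).2), hlt, Prod.ext hb.symm rfl⟩

end BagInterp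

/-! ### The map from the canonical model to a model -/

section Hom

variable {I : BagInterp.{v} Ind Con Rol} {T : TBox Con Rol} {𝒜 : BagABox Ind Con Rol}

/-- The choice of edges of a model for the anonymous successors of the individuals. -/
noncomputable def succEdge (h : I.IsModel T 𝒜) (R : DLRole Rol) (a : Ind) : ℕ → I.Dom × ℕ :=
  (h.exists_edges R a).choose

open Classical in
/-- The image of an element of the canonical model in a model, by recursion on the word. -/
noncomputable def homWord (h : I.IsModel T 𝒜) (a : Ind) (j : ℕ) : List (DLRole Rol) → I.Dom
  | [] => I.ind a
  | [R] => (succEdge h R a j).1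
  | R :: S :: w =>
    if hv : ∃ v, I.role R (homWord h a j (S :: w), v) ≠ 0 then hv.choose else I.ind a

/-- The map of the canonical model to a model. -/
noncomputable def hom (h : I.IsModel T 𝒜) (d : Elem.{u} Ind Rol) : I.Dom :=
  homWord h d.root d.idx d.word

theorem hom_parent (h : I.IsModel T 𝒜) (a : Ind) (j : ℕ) (R : DLRole Rol)
    (w : List (DLRole Rol)) :
    hom h (parent (⟨a, j, R :: w⟩ : Elem.{u} Ind Rol)) = homWord h a j w := by
  cases w <;> rfl

/-- By induction along the word: the edge into the previous element puts its image into ∃S⁻, and the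
chain condition then yields an R-successor. Hence the default value in `homWord` is never taken at
valid elements. -/
theorem hom_edge (h : I.IsModel T 𝒜) {a : Ind} {j : ℕ} {R : DLRole Rol}
    {w : List (DLRole Rol)} (hd : (⟨a, j, R :: w⟩ : Elem.{u} Ind Rol).Valid T 𝒜) :
    I.role R (homWord h a j w, homWord h a j (R :: w)) ≠ 0 := by
  induction w generalizing R with
  | nil =>
    have h₁ := ((h.exists_edges R a).choose_spec.1 j hd.1).1
    exact (bot_le.trans_lt h₁).ne'
  | cons S w ih =>
    obtain ⟨⟨h₁, -⟩, h₂⟩ := (valid_parent T 𝒜).1 hd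
    have h₃ := ih h₂
    have hv : ∃ v, I.role R (homWord h a j (S :: w), v) ≠ 0 := by
      refine bagSum_ne_zero fun h₀ => h₃ ?_
      have h₄ := h.1.concept_le h₁ (homWord h a j (S :: w))
      have h₅ : I.role S.swap (homWord h a j (S :: w), homWord h a j w) ≤ _ :=
        le_bagSum (fun v => I.role S.swap (homWord h a j (S :: w), v)) _
      rw [BagInterp.role_swap] at h₅
      exact le_antisymm (h₅.trans (h₄.trans h₀.le)) bot_le
    rw [homWord, dif_pos hv]
    exact hv.choose_spec

/-- At an anonymous element the type is at most 1, and the image of the incoming edge already forces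
multiplicity at least 1. -/
theorem tp_le_hom (h : I.IsModel T 𝒜) {d : Elem.{u} Ind Rol} (hd : d.Valid T 𝒜)
    (C : DLConcept Con Rol) : d.tp T 𝒜 C ≤ I.concept C (hom h d) := by
  obtain ⟨a, j, _ | ⟨R, w⟩⟩ := d
  · exact h.closure_le C a
  · by_cases hC : T.Sub (.ex R.swap) C
    · simp only [tp, iv_of hC]
      refine le_trans ?_ (h.1.concept_le hC _)
      refine le_trans ?_ (le_bagSum _ (homWord h a j w))
      rw [BagInterp.role_swap, Order.one_le_iff_ne_zero]
      exact hom_edge h hd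
    · simp [tp, hC]

theorem canon_concept_le (h : I.IsModel T 𝒜) (C : DLConcept Con Rol) (d : Elem.{u} Ind Rol) :
    (canon T 𝒜).concept C d ≤ I.concept C (hom h d) := by
  rw [canon_concept]
  by_cases hd : d.Valid T 𝒜
  · simpa [hd] using tp_le_hom h hd C
  · simp [hd]

/-- The canonical model of a satisfiable ontology is a model. -/
theorem canon_isModel (h : I.IsModel T 𝒜) : (canon.{u} T 𝒜).IsModel T 𝒜 := by
  refine ⟨fun α hα => ?_, canon_satABox T 𝒜⟩
  cases α with
  | incl C D =>
    intro (d : Elem.{u} Ind Rol)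
    rw [canon_concept T 𝒜 C d, canon_concept T 𝒜 D d]
    gcongr
    exact tp_mono T 𝒜 (.single hα) d
  -- Disjointness is inherited from the given model, since `hom` does not decrease concept
  -- multiplicities.
  | disj C D =>
    funext d
    have h₁ : min (I.concept C (hom h d)) (I.concept D (hom h d)) = 0 :=
      congrFun (h.1 _ hα) (hom h d)
    change min ((canon T 𝒜).concept C d) ((canon T 𝒜).concept D d) = 0
    exact le_antisymm ((min_le_min (canon_concept_le h C d) (canon_concept_le h D d)).trans h₁.le)
      bot_le

/-- The copy of an edge of a model to which the `k`-th copy of an edge of the canonical model is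
mapped. -/
noncomputable def label (h : I.IsModel T 𝒜) (d e : Elem.{u} Ind Rol) (k : ℕ) : ℕ :=
  match d.word, e.word with
  | [], [] => k
  | [], R :: _ => (succEdge h R e.root e.idx).2
  | R :: _, [] => (succEdge h R d.root d.idx).2
  | _ :: _, _ :: _ => 0

theorem label_symm (h : I.IsModel T 𝒜) (d e : Elem.{u} Ind Rol) (k : ℕ) :
    label h d e k = label h e d k := by
  obtain ⟨a, j, _ | ⟨R, w⟩⟩ := d <;> obtain ⟨b, l, _ | ⟨S, v⟩⟩ := e <;> rfl

/-- A first edge carries the label chosen by `succEdge`; deeper down the label 0 suffices because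
the image edge is nonzero. -/
theorem label_lt_of_child (h : I.IsModel T 𝒜) {R : DLRole Rol} {d e : Elem.{u} Ind Rol}
    (hd : d.Valid T 𝒜) (he : e.Valid T 𝒜) (hc : Child R d e) (k : ℕ) :
    (label h d e k : ℕ∞) < I.role R (hom h d, hom h e) := by
  obtain rfl := eq_parent_of_child T 𝒜 hd hc
  obtain ⟨b, l, v⟩ := e
  obtain ⟨-, hw, -⟩ := hc
  generalize hq : (parent (⟨b, l, v⟩ : Elem.{u} Ind Rol)).word = w at hw
  obtain rfl : v = R :: w := hw
  rw [hom_parent]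
  cases w with
  | nil => exact ((h.exists_edges R b).choose_spec.1 l he.1).1
  | cons S w =>
    change ((0 : ℕ) : ℕ∞) < _
    exact pos_iff_ne_zero.2 (hom_edge h he)

theorem label_lt (h : I.IsModel T 𝒜) {R : DLRole Rol} {d e : Elem.{u} Ind Rol} {k : ℕ}
    (hk : (k : ℕ∞) < (canon T 𝒜).role R (d, e)) :
    (label h d e k : ℕ∞) < I.role R (hom h d, hom h e) := by
  rw [canon_role] at hk
  have hne := (bot_le.trans_lt hk).ne'
  obtain ⟨hd, he⟩ := iv_ne_zero.1 (left_ne_zero_of_mul hne)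
  by_cases hw : d.word = [] ∧ e.word = []
  · rw [iv_of ⟨hd, he⟩, one_mul, edge, if_pos hw] at hk
    obtain ⟨a, j, w⟩ := d
    obtain ⟨b, l, v⟩ := e
    obtain ⟨rfl, rfl⟩ := hw
    exact hk.trans_le (h.2.aboxRole_le R a b)
  · have hr := right_ne_zero_of_mul hne
    rw [edge_of_ne_nil _ (by tauto)] at hr
    rcases iv_ne_zero.1 hr with hc | hc
    · exact label_lt_of_child h hd he hc k
    · rw [label_symm, ← BagInterp.role_swap]
      exact label_lt_of_child h he hd hc k

/-- Edges at anonymous elements are indicators. This is why `label` may forget the copy number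
there. -/
theorem lt_one_of_ne_nil {R : DLRole Rol} {d e : Elem.{u} Ind Rol} {k : ℕ}
    (hk : (k : ℕ∞) < (canon T 𝒜).role R (d, e)) (hw : d.word ≠ [] ∨ e.word ≠ []) : k = 0 := by
  rw [canon_role, edge_of_ne_nil _ hw, ← iv_and] at hk
  have : iv ((d.Valid T 𝒜 ∧ e.Valid T 𝒜) ∧ (Child R d e ∨ Child R.swap e d)) ≤ 1 := by
    unfold iv; split_ifs <;> simp
  have := hk.trans_le this
  exact_mod_cast Order.lt_one_iff.1 this

/-- The map to a model is locally injective on edges. -/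
theorem hom_locally_injective (h : I.IsModel T 𝒜) {R : DLRole Rol} {d e e' : Elem.{u} Ind Rol}
    {k k' : ℕ} (hk : (k : ℕ∞) < (canon T 𝒜).role R (d, e))
    (hk' : (k' : ℕ∞) < (canon T 𝒜).role R (d, e')) (he : hom h e = hom h e')
    (hl : label h d e k = label h d e' k') : e = e' := by
  obtain ⟨a, j, _ | ⟨S, w⟩⟩ := d
  · have key : ∀ {e : Elem.{u} Ind Rol} {k : ℕ},
        (k : ℕ∞) < (canon T 𝒜).role R (⟨a, j, []⟩, e) →
          (∃ b, e = ⟨b, 0, []⟩ ∧ (k : ℕ∞) < aboxRole 𝒜 R a b) ∨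
          ∃ l : ℕ, e = ⟨a, l, [R]⟩ ∧ (l : ℕ∞) < gap T 𝒜 R a := by
      intro e k hk
      rw [canon_role] at hk
      have hne := (bot_le.trans_lt hk).ne'
      obtain ⟨hd, he⟩ := iv_ne_zero.1 (left_ne_zero_of_mul hne)
      obtain ⟨b, l, _ | ⟨S, w⟩⟩ := e
      · obtain rfl : l = 0 := (valid_of_word_eq_nil T 𝒜 rfl).1 he
        rw [iv_of ⟨hd, he⟩, one_mul, edge, if_pos ⟨rfl, rfl⟩] at hk
        exact Or.inl ⟨b, rfl, hk⟩
      · have hr := right_ne_zero_of_mul hne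
        rw [edge_of_ne_nil _ (by simp)] at hr
        rcases iv_ne_zero.1 hr with ⟨h₁, h₂, -⟩ | ⟨-, h₂, -⟩
        · obtain rfl : a = b := h₁
          obtain ⟨rfl, rfl⟩ : S = R ∧ w = [] := by simpa using h₂
          exact Or.inr ⟨l, rfl, he.1⟩
        · simp at h₂
    -- An ABox edge and an anonymous edge never share an image copy, as `succEdge` avoids the copies
    -- used by the ABox.
    have sep : ∀ {b : Ind} {k l : ℕ}, (k : ℕ∞) < aboxRole 𝒜 R a b → (l : ℕ∞) < gap T 𝒜 R a →
        I.ind b = (succEdge h R a l).1 → k = (succEdge h R a l).2 → False := by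
      rintro b k l h₁ h₂ h₃ rfl
      exact absurd h₁ (not_lt.2 (((h.exists_edges R a).choose_spec.1 l h₂).2 b h₃.symm))
    rcases key hk with ⟨b, rfl, hb⟩ | ⟨l, rfl, hb⟩ <;>
      rcases key hk' with ⟨b', rfl, hb'⟩ | ⟨l', rfl, hb'⟩
    · obtain rfl : b = b' := I.ind_injective he
      rfl
    · exact (sep hb hb' he hl).elim
    · exact (sep hb' hb he.symm hl.symm).elim
    · rw [(h.exists_edges R a).choose_spec.2 hb hb' (Prod.ext he hl)]
  -- At an anonymous element both ends equal the unique neighbour for R.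
  · have hd := (bot_le.trans_lt hk).ne'
    rw [canon_role] at hd
    have hd := (iv_ne_zero.1 (left_ne_zero_of_mul hd)).1
    rw [canon_role_cons T 𝒜 a j R S w hd] at hk hk'
    rw [(iv_ne_zero.1 (bot_le.trans_lt hk).ne').1, (iv_ne_zero.1 (bot_le.trans_lt hk').ne').1]

theorem hom_locally_injective_left (h : I.IsModel T 𝒜) {R : DLRole Rol}
    {d e e' : Elem.{u} Ind Rol} {k k' : ℕ} (hk : (k : ℕ∞) < (canon T 𝒜).role R (e, d))
    (hk' : (k' : ℕ∞) < (canon T 𝒜).role R (e', d)) (he : hom h e = hom h e')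
    (hl : label h e d k = label h e' d k') : e = e' := by
  rw [label_symm h e, label_symm h e'] at hl
  exact hom_locally_injective h (R := R.swap)
    (hk.trans_eq ((canon T 𝒜).role_swap R d e).symm)
    (hk'.trans_eq ((canon T 𝒜).role_swap R d e').symm) he hl

theorem label_injective (h : I.IsModel T 𝒜) {R : DLRole Rol} {d e : Elem.{u} Ind Rol}
    {k k' : ℕ} (hk : (k : ℕ∞) < (canon T 𝒜).role R (d, e))
    (hk' : (k' : ℕ∞) < (canon T 𝒜).role R (d, e)) (hl : label h d e k = label h d e k') :
    k = k' := by
  by_cases hw : d.word ≠ [] ∨ e.word ≠ []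
  · rw [lt_one_of_ne_nil hk hw, lt_one_of_ne_nil hk' hw]
  · push Not at hw
    simpa only [label, hw.1, hw.2] using hl

end Hom

/-! ### Universality of the canonical model -/

section Universal

variable {Vars : Type} [DecidableEq Vars] {q : CQ Ind Vars Con Rol}

variable {I : BagInterp.{v} Ind Con Rol} {T : TBox Con Rol} {𝒜 : BagABox Ind Con Rol}

theorem term_hom (h : I.IsModel T 𝒜) {V : Type} (lam : V → Elem.{u} Ind Rol) (t : Term Ind V) :
    I.term (fun v => hom h (lam v)) t = hom h ((canon T 𝒜).term lam t) := by
  cases t <;> rfl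

/-- The copy of the image of an atom to which a copy of the atom is mapped. -/
noncomputable def atomLabel (h : I.IsModel T 𝒜) {V : Type} (lam : V → Elem.{u} Ind Rol) :
    Atom Ind V Con Rol → ℕ → ℕ
  | .con _ _, k => k
  | .rol _ t₁ t₂, k => label h ((canon T 𝒜).term lam t₁) ((canon T 𝒜).term lam t₂) k

theorem atomLabel_lt (h : I.IsModel T 𝒜) {V : Type} (lam : V → Elem.{u} Ind Rol)
    (α : Atom Ind V Con Rol) {k : ℕ} (hk : (k : ℕ∞) < (canon T 𝒜).atom lam α) :
    (atomLabel h lam α k : ℕ∞) < I.atom (fun v => hom h (lam v)) α := by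
  cases α with
  | con A t =>
    refine lt_of_lt_of_le hk ?_
    change _ ≤ I.con A (I.term _ t)
    rw [term_hom]
    exact canon_concept_le h (.atomic A) _
  | rol P t₁ t₂ =>
    change _ < I.rol P (I.term _ t₁, I.term _ t₂)
    rw [term_hom, term_hom]
    exact label_lt (R := .atomic P) h hk

/-- The canonical model is universal for rooted queries. -/
theorem canon_answers_le (hq : q.Rooted) (h : I.IsModel T 𝒜) :
    q.answers (canon.{u} T 𝒜) ≤ q.answers I := by
  intro a
  unfold CQ.answers
  -- Indexing by positions gives repeated atoms independent copy numbers.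
  simp only [← Fin.prod_univ_fun_getElem]
  refine bagSum_prod_le _ _
    (fun lam => ⟨fun v => hom h (lam.1 v), fun v hv => ?_, fun e he => ?_⟩)
    (fun lam x k => atomLabel h lam.1 q.atoms[x.1] k) ?_ ?_
  · exact congrArg (hom h) (lam.2.1 v hv)
  · exact (congrArg (hom h) (lam.2.2 e he)).trans (term_hom h lam.1 e.2).symm
  · exact fun lam x k hk => atomLabel_lt h lam.1 _ hk
  · intro lam lam' k k' hk hk' hm hl
    have hcomp : ∀ t, hom h ((canon T 𝒜).term lam.1 t) = hom h ((canon T 𝒜).term lam'.1 t) := by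
      intro t
      exact (term_hom h lam.1 t).symm.trans
        ((congrArg (fun f => I.term f t) (congrArg Subtype.val hm)).trans (term_hom h lam'.1 t))
    have hcls : ∀ (mu : q.Valuation (canon.{u} T 𝒜) a) {s t : Term Ind q.V},
        termSetoid q.eqs s t → (canon T 𝒜).term mu.1 s = (canon T 𝒜).term mu.1 t :=
      fun mu _ _ hst => eq_of_termSetoid (f := (canon T 𝒜).term mu.1) mu.2.2 hst
    have hmk : ∀ s : Term Ind q.V, (canon T 𝒜).term lam.1 s = (canon T 𝒜).term lam'.1 s ↔
        ∀ t, (Quotient.mk _ t : q.Node) = Quotient.mk _ s →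
          (canon T 𝒜).term lam.1 t = (canon T 𝒜).term lam'.1 t := by
      intro s
      refine ⟨fun hs t ht => ?_, fun hs => hs s rfl⟩
      rw [hcls lam (Quotient.exact ht), hcls lam' (Quotient.exact ht), hs]
    -- Both matches agree at the roots, and agreement at one end of a role atom passes to the other
    -- by local injectivity.
    have hlam : lam.1 = lam'.1 := by
      funext v
      refine (hmk (.var v)).2 (hq.induction (p := fun c => ∀ t, Quotient.mk _ t = c →
        (canon T 𝒜).term lam.1 t = (canon T 𝒜).term lam'.1 t) ?_ ?_ v)
      · intro s hs
        rw [← hmk]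
        cases s with
        | ind c => rfl
        | var v => exact (lam.2.1 v.1 hs).trans (lam'.2.1 v.1 hs).symm
      · intro P t₁ t₂ hmem
        rw [← hmk, ← hmk]
        obtain ⟨x, hx, hxα⟩ := List.getElem_of_mem hmem
        have h₁ := hk ⟨x, hx⟩
        have h₂ := hk' ⟨x, hx⟩
        have h₃ := hl ⟨x, hx⟩
        simp only [hxα] at h₁ h₂ h₃
        constructor
        · intro heq
          change (_ : ℕ∞) < (canon T 𝒜).role (.atomic P) (_, _) at h₁ h₂
          change label h _ _ _ = label h _ _ _ at h₃
          rw [← heq] at h₂ h₃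
          exact hom_locally_injective h h₁ h₂ (hcomp t₂) h₃
        · intro heq
          change (_ : ℕ∞) < (canon T 𝒜).role (.atomic P) (_, _) at h₁ h₂
          change label h _ _ _ = label h _ _ _ at h₃
          rw [← heq] at h₂ h₃
          exact hom_locally_injective_left h h₁ h₂ (hcomp t₁) h₃
    obtain rfl : lam = lam' := Subtype.ext hlam
    refine ⟨rfl, funext fun x => ?_⟩
    have h₁ := hk x
    have h₂ := hk' x
    have h₃ := hl x
    revert h₁ h₂ h₃
    generalize q.atoms[x.1] = α
    intro h₁ h₂ h₃
    cases α with
    | con A t => exact h₃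
    | rol P t₁ t₂ => exact label_injective (R := .atomic P) h h₁ h₂ h₃

/-- The bag certain answers to a rooted query are its answers over the canonical model. -/
theorem certain_eq_canon (hq : q.Rooted) (hs : Satisfiable.{u} T 𝒜) :
    q.certain.{u} T 𝒜 = q.answers (canon.{u} T 𝒜) := by
  obtain ⟨I, hI⟩ := hs
  unfold CQ.certain
  exact le_antisymm (iInf₂_le (canon T 𝒜) (canon_isModel hI)) (le_iInf₂ fun J hJ => canon_answers_le hq hJ)

end Universal

end

/-! ### Functions expressible in the bag algebra -/

section

variable {Ind Vars Con Rol : Type} [DecidableEq Vars] [Nonempty Ind]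

/-- The function of the ABox and of the assignment of individuals to variables is the evaluation of
a BALG¹_ε-query with answer variables `X`. -/
def Expressible (X : Finset Vars) (f : BagABox Ind Con Rol → (Vars → Ind) → ℕ∞) : Prop :=
  ∃ Q : BALG Ind Vars Con Rol X, ∀ 𝒜 (a : Vars → Ind),
    Q.eval (aboxInterp 𝒜) (fun v => a v.1) = f 𝒜 a

namespace Expressible

variable {X Y : Finset Vars} {f g : BagABox Ind Con Rol → (Vars → Ind) → ℕ∞}

theorem congr (hf : Expressible X f) (h : ∀ 𝒜 a, f 𝒜 a = g 𝒜 a) : Expressible X g := by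
  obtain ⟨Q, hQ⟩ := hf
  exact ⟨Q, fun 𝒜 a => (hQ 𝒜 a).trans (h 𝒜 a)⟩

theorem eq_of_eqOn (hf : Expressible X f) (𝒜 : BagABox Ind Con Rol) {a b : Vars → Ind}
    (h : ∀ x ∈ X, a x = b x) : f 𝒜 a = f 𝒜 b := by
  obtain ⟨Q, hQ⟩ := hf
  rw [← hQ, ← hQ]
  congr 1
  exact funext fun v => h v.1 v.2

theorem con (A : Con) (x : Vars) :
    Expressible {x} fun (𝒜 : BagABox Ind Con Rol) a => (𝒜 (.con A (a x)) : ℕ∞) := by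
  have h : ∀ v : {v // v ∈ ({x} : Finset Vars)},
      (Atom.con A (.var ⟨x, by simp⟩) : Atom Ind _ Con Rol).Mentions (.var v) := by
    rintro ⟨v, hv⟩
    obtain rfl := Finset.mem_singleton.1 hv
    rfl
  exact ⟨.atom _ h, fun _ _ => rfl⟩

theorem rol (P : Rol) (x y : Vars) :
    Expressible {x, y} fun (𝒜 : BagABox Ind Con Rol) a => (𝒜 (.rol P (a x) (a y)) : ℕ∞) := by
  have h : ∀ v : {v // v ∈ ({x, y} : Finset Vars)},
      (Atom.rol P (.var ⟨x, by simp⟩) (.var ⟨y, by simp⟩) :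
        Atom Ind _ Con Rol).Mentions (.var v) := by
    rintro ⟨v, hv⟩
    simp only [Finset.mem_insert, Finset.mem_singleton] at hv
    rcases hv with rfl | rfl
    · exact Or.inl rfl
    · exact Or.inr rfl
  exact ⟨.atom _ h, fun _ _ => rfl⟩

theorem mul (hf : Expressible X f) (hg : Expressible Y g) :
    Expressible (X ∪ Y) fun 𝒜 a => f 𝒜 a * g 𝒜 a := by
  obtain ⟨Q, hQ⟩ := hf
  obtain ⟨Q', hQ'⟩ := hg
  exact ⟨.and rfl Q Q', fun 𝒜 a => congrArg₂ (· * ·) (hQ 𝒜 a) (hQ' 𝒜 a)⟩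

theorem sup (hf : Expressible X f) (hg : Expressible X g) :
    Expressible X fun 𝒜 a => f 𝒜 a ⊔ g 𝒜 a := by
  obtain ⟨Q, hQ⟩ := hf
  obtain ⟨Q', hQ'⟩ := hg
  exact ⟨.maxUnion Q Q', fun 𝒜 a => congrArg₂ max (hQ 𝒜 a) (hQ' 𝒜 a)⟩

theorem add (hf : Expressible X f) (hg : Expressible X g) :
    Expressible X fun 𝒜 a => f 𝒜 a + g 𝒜 a := by
  obtain ⟨Q, hQ⟩ := hf
  obtain ⟨Q', hQ'⟩ := hg
  exact ⟨.arUnion Q Q', fun 𝒜 a => congrArg₂ (· + ·) (hQ 𝒜 a) (hQ' 𝒜 a)⟩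

theorem sub (hf : Expressible X f) (hg : Expressible X g) :
    Expressible X fun 𝒜 a => f 𝒜 a - g 𝒜 a := by
  obtain ⟨Q, hQ⟩ := hf
  obtain ⟨Q', hQ'⟩ := hg
  exact ⟨.diff Q Q', fun 𝒜 a => congrArg₂ (· - ·) (hQ 𝒜 a) (hQ' 𝒜 a)⟩

theorem eqVar (hf : Expressible X f) {x : Vars} (hx : x ∈ X) (y : Vars) :
    Expressible (insert y X) fun 𝒜 a => iv (a x = a y) * f 𝒜 a := by
  obtain ⟨Q, hQ⟩ := hf
  refine ⟨.eq Q ⟨x, hx⟩ (.var ⟨y, Finset.mem_insert_self y X⟩) ?_, fun 𝒜 a => ?_⟩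
  · simp [Term.vars]
  · classical
    change (if a x = a y then Q.eval (aboxInterp 𝒜) (fun v => a v.1) else _) = _ * f 𝒜 a
    rw [← hQ]
    by_cases h : a x = a y <;> simp [h]

theorem eqInd (hf : Expressible X f) {x : Vars} (hx : x ∈ X) (c : Ind) :
    Expressible X fun 𝒜 a => iv (a x = c) * f 𝒜 a := by
  obtain ⟨Q, hQ⟩ := hf
  refine ⟨.eq Q ⟨x, hx⟩ (.ind c) ?_, fun 𝒜 a => ?_⟩
  · simp [Term.vars]
  · classical
    change (if a x = c then Q.eval (aboxInterp 𝒜) (fun v => a v.1) else _) = _ * f 𝒜 a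
    rw [← hQ]
    by_cases h : a x = c <;> simp [h]

theorem exists_vars (hXY : Disjoint X Y) (hf : Expressible (X ∪ Y) f) :
    Expressible X fun 𝒜 a => bagSum fun b : {v // v ∈ Y} → Ind =>
      f 𝒜 fun v => if h : v ∈ Y then b ⟨v, h⟩ else a v := by
  obtain ⟨Q, hQ⟩ := hf
  refine ⟨.ex Y hXY rfl Q, fun 𝒜 a => ?_⟩
  change (bagSum fun b : {v // v ∈ Y} → Ind => Q.eval _ _) = _
  refine congrArg bagSum (funext fun b => ?_)
  rw [← hQ]
  congr 1
  funext v
  by_cases h : v.1 ∈ X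
  · refine (dif_pos h).trans ?_
    rw [dif_neg (Finset.disjoint_left.1 hXY h)]
  · refine (dif_neg h).trans ?_
    rw [dif_pos ((Finset.mem_union.1 v.2).resolve_left h)]

theorem exists_var {y : Vars} (hy : y ∉ X) (hf : Expressible (insert y X) f) :
    Expressible X fun 𝒜 a => bagSum fun b : Ind => f 𝒜 (Function.update a y b) := by
  rw [Finset.insert_eq, Finset.union_comm] at hf
  refine (hf.exists_vars (by simpa using hy)).congr fun 𝒜 a => ?_
  let e : Ind ≃ ({v // v ∈ ({y} : Finset Vars)} → Ind) :=
    ⟨fun b _ => b, fun b => b ⟨y, by simp⟩, fun b => rfl, fun b => by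
      funext ⟨v, hv⟩
      obtain rfl := Finset.mem_singleton.1 hv
      rfl⟩
  rw [← bagSum_equiv e]
  refine congrArg bagSum (funext fun b => congrArg (f 𝒜) (funext fun v => ?_))
  by_cases h : v = y
  · subst h; simp [e]
  · simp [h]

/-- Substitution of an individual for a variable, as selection `y = c` followed by projection. -/
theorem pin {y : Vars} (hy : y ∉ X) (hf : Expressible (insert y X) f) (c : Ind) :
    Expressible X fun 𝒜 a => f 𝒜 (Function.update a y c) := by
  refine ((hf.eqInd (Finset.mem_insert_self y X) c).exists_var hy).congr fun 𝒜 a => ?_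
  rw [bagSum_single c]
  · simp
  · intro b hb
    simp [hb]

theorem zero (hf : Expressible X f) : Expressible X fun (_ : BagABox Ind Con Rol) _ => 0 :=
  (hf.sub hf).congr fun _ _ => tsub_self _

/-- Zero is written as a difference of a query with itself, so empty sums need some query with these
answer variables. -/
theorem exists_expressible [Nonempty Con] [Infinite Vars] (X : Finset Vars) :
    ∃ f : BagABox Ind Con Rol → (Vars → Ind) → ℕ∞, Expressible X f := by
  obtain ⟨A⟩ := ‹Nonempty Con›
  induction X using Finset.induction_on with
  | empty =>
    obtain ⟨x⟩ : Nonempty Vars := inferInstance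
    exact ⟨_, (con A x).exists_var (X := ∅) (by simp)⟩
  | insert x X _ ih =>
    obtain ⟨f, hf⟩ := ih
    exact ⟨_, (con A x).mul hf⟩

theorem finset_sum {ι : Type*} (s : Finset ι)
    {F : ι → BagABox Ind Con Rol → (Vars → Ind) → ℕ∞} (hf : Expressible X f)
    (hF : ∀ i ∈ s, Expressible X (F i)) : Expressible X fun 𝒜 a => ∑ i ∈ s, F i 𝒜 a := by
  classical
  induction s using Finset.induction_on with
  | empty => simpa using hf.zero
  | insert i s hi ih =>
    simp only [Finset.sum_insert hi]
    exact (hF i (by simp)).add (ih fun j hj => hF j (by simp [hj]))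

theorem finset_sup {ι : Type*} (s : Finset ι)
    {F : ι → BagABox Ind Con Rol → (Vars → Ind) → ℕ∞} (hf : Expressible X f)
    (hF : ∀ i ∈ s, Expressible X (F i)) : Expressible X fun 𝒜 a => s.sup fun i => F i 𝒜 a := by
  classical
  induction s using Finset.induction_on with
  | empty => simpa using hf.zero
  | insert i s hi ih =>
    simp only [Finset.sup_insert]
    exact (hF i (by simp)).sup (ih fun j hj => hF j (by simp [hj]))

theorem concept [Infinite Vars] (C : DLConcept Con Rol) (x : Vars) :
    Expressible {x} fun (𝒜 : BagABox Ind Con Rol) (a : Vars → Ind) =>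
      (aboxInterp 𝒜).concept C (a x) := by
  obtain ⟨y, hy⟩ := Infinite.exists_notMem_finset ({x} : Finset Vars)
  have hxy : x ≠ y := fun h => hy (by simp [h])
  match C with
  | .atomic A => exact con A x
  | .ex (.atomic P) =>
    have h : Expressible (insert y {x}) _ := Finset.pair_comm x y ▸ rol (Ind := Ind) (Con := Con) P x y
    refine (h.exists_var hy).congr fun 𝒜 a => ?_
    simp only [Function.update_self, Function.update_of_ne hxy]
    rfl
  | .ex (.inv P) =>
    have h : Expressible (insert y {x}) _ := rol (Ind := Ind) (Con := Con) P y x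
    refine (h.exists_var hy).congr fun 𝒜 a => ?_
    simp only [Function.update_self, Function.update_of_ne hxy]
    rfl

theorem closure [Infinite Vars] (T : TBox Con Rol) (C : DLConcept Con Rol) (x : Vars) :
    Expressible {x} fun (𝒜 : BagABox Ind Con Rol) (a : Vars → Ind) =>
      BagDL.closure T 𝒜 C (a x) := by
  refine (finset_sup (T.finite_sub C).toFinset (concept C x) fun C₀ _ => concept C₀ x).congr
    fun 𝒜 a => ?_
  rw [Finset.sup_eq_iSup]
  simp [BagDL.closure]

theorem gap [Infinite Vars] (T : TBox Con Rol) (R : DLRole Rol) (x : Vars) :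
    Expressible {x} fun (𝒜 : BagABox Ind Con Rol) (a : Vars → Ind) =>
      BagDL.gap T 𝒜 R (a x) :=
  (closure T (.ex R) x).sub (concept (.ex R) x)

theorem cap [Infinite Vars] (T : TBox Con Rol) {w : List (DLRole Rol)} (hw : w ≠ []) (x : Vars) :
    Expressible {x} fun (𝒜 : BagABox Ind Con Rol) (a : Vars → Ind) =>
      BagDL.cap T 𝒜 (a x) w := by
  match w with
  | [R] => exact gap T R x
  | _ :: S :: w => exact cap T (w := S :: w) (by simp) x

/-- A set of equalities may be added to a query if it makes every new variable equal to an old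
one. -/
theorem equalities (hf : Expressible Y f) (hY : Y ⊆ X) (E : List (Vars × Vars))
    (hE : ∀ e ∈ E, e.1 ∈ X ∧ e.2 ∈ X)
    (hX : ∀ x ∈ X, ∃ y ∈ Y, ∀ a : Vars → Ind, (∀ e ∈ E, a e.1 = a e.2) → a x = a y) :
    Expressible X fun 𝒜 a => iv (∀ e ∈ E, a e.1 = a e.2) * f 𝒜 a := by
  choose! r hr hr' using hX
  -- A selection may introduce its right-hand variable, so each missing `z` enters through an
  -- equality with its representative `r z` in `Y`.
  have key : ∀ Z : Finset Vars, Z ⊆ X →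
      Expressible (Y ∪ Z) fun 𝒜 a => iv (∀ z ∈ Z, a (r z) = a z) * f 𝒜 a := by
    intro Z
    induction Z using Finset.induction_on with
    | empty => intro _; simpa using hf
    | insert z Z _ ih =>
      intro hZ
      have h := (ih fun x hx => hZ (by simp [hx])).eqVar
        (Finset.mem_union_left Z (hr z (hZ (by simp)))) z
      rw [← Finset.union_insert] at h
      refine h.congr fun 𝒜 a => ?_
      rw [← mul_assoc, ← iv_and, Finset.forall_mem_insert]
  -- Once all variables are present, the original equalities are plain selections; they imply the
  -- auxiliary ones.
  have key₂ : ∀ L : List (Vars × Vars), (∀ e ∈ L, e.1 ∈ X ∧ e.2 ∈ X) →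
      Expressible X fun 𝒜 a => iv (∀ e ∈ L, a e.1 = a e.2) *
        (iv (∀ z ∈ X, a (r z) = a z) * f 𝒜 a) := by
    intro L
    induction L with
    | nil =>
      intro _
      have h := key X subset_rfl
      rw [Finset.union_eq_right.2 hY] at h
      simpa using h
    | cons e L ih =>
      intro hL
      have h := (ih fun e' he' => hL e' (by simp [he'])).eqVar (hL e (by simp)).1 e.2
      rw [Finset.insert_eq_of_mem (hL e (by simp)).2] at h
      refine h.congr fun 𝒜 a => ?_
      rw [← mul_assoc, ← iv_and, List.forall_mem_cons]
  refine (key₂ E hE).congr fun 𝒜 a => ?_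
  rw [← mul_assoc, ← iv_and]
  congr 1
  exact iv_congr ⟨And.left, fun h => ⟨h, fun z hz => (hr' z hz a h).symm⟩⟩

end Expressible

/-- The function is expressible, or it is the constant `1` and no variables are involved. -/
def ExpressibleOrOne (X : Finset Vars) (f : BagABox Ind Con Rol → (Vars → Ind) → ℕ∞) : Prop :=
  Expressible X f ∨ X = ∅ ∧ ∀ 𝒜 a, f 𝒜 a = 1

namespace ExpressibleOrOne

variable {X Y : Finset Vars} {f g : BagABox Ind Con Rol → (Vars → Ind) → ℕ∞}

theorem mul (hf : ExpressibleOrOne X f) (hg : ExpressibleOrOne Y g) :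
    ExpressibleOrOne (X ∪ Y) fun 𝒜 a => f 𝒜 a * g 𝒜 a := by
  rcases hf with hf | ⟨rfl, hf⟩ <;> rcases hg with hg | ⟨rfl, hg⟩
  · exact Or.inl (hf.mul hg)
  · refine Or.inl ?_
    rw [Finset.union_empty]
    exact hf.congr fun 𝒜 a => by rw [hg, mul_one]
  · refine Or.inl ?_
    rw [Finset.empty_union]
    exact hg.congr fun 𝒜 a => by rw [hf, one_mul]
  · exact Or.inr ⟨by simp, fun 𝒜 a => by simp only [hf, hg, mul_one]⟩

theorem one : ExpressibleOrOne ∅ fun (_ : BagABox Ind Con Rol) (_ : Vars → Ind) => 1 :=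
  Or.inr ⟨rfl, fun _ _ => rfl⟩

/-- The algebra has no empty join, so trivial factors are dropped instead of being expressed. -/
theorem list_prod {ι : Type*} (l : List ι) {Z : ι → Finset Vars}
    {F : ι → BagABox Ind Con Rol → (Vars → Ind) → ℕ∞}
    (hF : ∀ i ∈ l, ExpressibleOrOne (Z i) (F i)) :
    ∃ Y : Finset Vars, (∀ x, x ∈ Y ↔ ∃ i ∈ l, x ∈ Z i) ∧
      ExpressibleOrOne Y fun 𝒜 a => (l.map fun i => F i 𝒜 a).prod := by
  induction l with
  | nil => exact ⟨∅, by simp, one⟩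
  | cons i l ih =>
    obtain ⟨Y, hY, h⟩ := ih fun j hj => hF j (by simp [hj])
    refine ⟨Z i ∪ Y, by simp [hY], ?_⟩
    simpa only [List.map_cons, List.prod_cons] using (hF i (by simp)).mul h

end ExpressibleOrOne

/-- Individuals of a query are first written as fresh variables `nu c`, to be treated like other
terms in equalities; here they are restored one by one. -/
theorem Expressible.pin_all {X : Finset Vars} {f : BagABox Ind Con Rol → (Vars → Ind) → ℕ∞}
    {nu : Ind → Vars} (hnu : Function.Injective nu) (hX : ∀ c, nu c ∉ X)
    {fix : (Vars → Ind) → Vars → Ind} (hfix : ∀ a c, fix a (nu c) = c)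
    (hfixX : ∀ a, ∀ x ∈ X, fix a x = a x) (D : Finset Ind)
    (hf : Expressible (X ∪ D.image nu) f) : Expressible X fun 𝒜 a => f 𝒜 (fix a) := by
  classical
  induction D using Finset.induction_on generalizing f with
  | empty =>
    rw [Finset.image_empty, Finset.union_empty] at hf
    exact hf.congr fun 𝒜 a => hf.eq_of_eqOn 𝒜 fun x hx => (hfixX a x hx).symm
  | insert c D hc ih =>
    rw [Finset.image_insert, Finset.union_insert] at hf
    have hmem : nu c ∉ X ∪ D.image nu := by
      simp only [Finset.mem_union, hX, Finset.mem_image, false_or, not_exists, not_and]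
      intro d hd h
      exact hc (hnu h ▸ hd)
    refine (ih (hf.pin hmem c)).congr fun 𝒜 a => congrArg (f 𝒜) ?_
    rw [Function.update_eq_self_iff, hfix]

end

/-! ### Matches in the canonical model with prescribed words -/

section

variable {Ind Vars Con Rol : Type}

section Words

variable {V : Type} (w : V → List (DLRole Rol))

/-- The word of the image of a term. -/
def termWord : Term Ind V → List (DLRole Rol)
  | .var v => w v
  | .ind _ => []

/-- The individual above the image of a term. -/
def termRoot (α : V → Ind) : Term Ind V → Ind
  | .var v => α v
  | .ind c => c

/-- The copy to which the image of a term belongs. -/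
def termIdx (j : V → ℕ) : Term Ind V → ℕ
  | .var v => j v
  | .ind _ => 0

/-- The condition that an atom puts on the words. -/
def AtomWords (T : TBox Con Rol) : Atom Ind V Con Rol → Prop
  | .con A t => ∀ R ∈ (termWord w t).head?, T.Sub (.ex R.swap) (.atomic A)
  | .rol P t₁ t₂ => (termWord w t₁ = [] ∧ termWord w t₂ = []) ∨
      termWord w t₂ = .atomic P :: termWord w t₁ ∨ termWord w t₁ = .inv P :: termWord w t₂

/-- The terms of an atom that lie below the same individual. -/
noncomputable def atomPairs : Atom Ind V Con Rol → List (Term Ind V × Term Ind V)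
  | .con _ _ => []
  | .rol _ t₁ t₂ =>
    open Classical in if termWord w t₁ = [] ∧ termWord w t₂ = [] then [] else [(t₁, t₂)]

/-- The multiplicity of an atom that is mapped to individuals, and `1` for the other atoms. -/
noncomputable def atomVal [Nonempty Ind] (T : TBox Con Rol) (𝒜 : BagABox Ind Con Rol)
    (τ : Term Ind V → Ind) : Atom Ind V Con Rol → ℕ∞
  | .con A t => open Classical in if termWord w t = [] then closure T 𝒜 (.atomic A) (τ t) else 1
  | .rol P t₁ t₂ =>
    open Classical in
    if termWord w t₁ = [] ∧ termWord w t₂ = [] then (𝒜 (.rol P (τ t₁) (τ t₂)) : ℕ∞) else 1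

end Words

section Count

variable [DecidableEq Vars] (q : CQ Ind Vars Con Rol) (T : TBox Con Rol)
  (w : q.V → List (DLRole Rol))

/-- The conditions that a query puts on the words of the images of its variables. -/
structure Words : Prop where
  chain : ∀ v, Chain T (w v)
  ans : ∀ x (h : x ∈ q.ans), w ⟨x, Finset.mem_union_left _ h⟩ = []
  eqs : ∀ e ∈ q.eqs, w e.1 = termWord w e.2
  atoms : ∀ β ∈ q.atoms, AtomWords w T β

/-- The pairs of terms that lie below the same individual. -/
noncomputable def pairs : List (Term Ind q.V × Term Ind q.V) :=
  q.eqs.map (fun e => (.var e.1, e.2)) ++ q.atoms.flatMap (atomPairs w)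

/-- The variables whose images lie in the same copy. -/
def copySetoid : Setoid q.V :=
  Relation.EqvGen.setoid fun v v' => (v, .var v') ∈ q.eqs ∨
    ∃ P, Atom.rol P (.var v) (.var v') ∈ q.atoms ∧ w v ≠ [] ∧ w v' ≠ []

variable {q T w}

theorem copySetoid_induction {M : Type*} {f : q.V → M}
    (h₁ : ∀ v v', (v, .var v') ∈ q.eqs → f v = f v')
    (h₂ : ∀ P v v', Atom.rol P (.var v) (.var v') ∈ q.atoms → w v ≠ [] → w v' ≠ [] → f v = f v')
    {v v' : q.V} (h : copySetoid q w v v') : f v = f v' := by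
  induction h with
  | rel s t h =>
    rcases h with h | ⟨P, h, hs, ht⟩
    · exact h₁ _ _ h
    · exact h₂ _ _ _ h hs ht
  | refl => rfl
  | symm _ _ _ ih => exact ih.symm
  | trans _ _ _ _ _ ih₁ ih₂ => exact ih₁.trans ih₂

theorem forall_pairs {p : Term Ind q.V × Term Ind q.V → Prop} :
    (∀ s ∈ pairs q w, p s) ↔ (∀ e ∈ q.eqs, p (.var e.1, e.2)) ∧
      ∀ P t₁ t₂, Atom.rol P t₁ t₂ ∈ q.atoms → ¬(termWord w t₁ = [] ∧ termWord w t₂ = []) →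
        p (t₁, t₂) := by
  simp only [pairs, List.forall_mem_append, List.forall_mem_map, List.mem_flatMap]
  refine and_congr Iff.rfl ⟨fun h P t₁ t₂ hα hw => h _ ⟨_, hα, ?_⟩, ?_⟩
  · simp [atomPairs, hw]
  · rintro h s ⟨α, hα, hs⟩
    cases α with
    | con A t => simp [atomPairs] at hs
    | rol P t₁ t₂ =>
      by_cases hw : termWord w t₁ = [] ∧ termWord w t₂ = []
      · simp [atomPairs, hw] at hs
      · simp only [atomPairs, hw, if_false, List.mem_singleton] at hs
        exact hs ▸ h P t₁ t₂ hα hw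

/-- Across a role atom between anonymous elements the words differ by a letter at the far end, which
leaves the edge at the individual, and hence `cap`, unchanged. -/
theorem cap_eq_of_copySetoid [Nonempty Ind] {𝒜 : BagABox Ind Con Rol} (hw : Words q T w)
    {τ : Term Ind q.V → Ind} (hp : ∀ p ∈ pairs q w, τ p.1 = τ p.2) {v v' : q.V}
    (h : copySetoid q w v v') :
    cap T 𝒜 (τ (.var v)) (w v) = cap T 𝒜 (τ (.var v')) (w v') := by
  rw [forall_pairs] at hp
  refine copySetoid_induction (f := fun v => cap T 𝒜 (τ (.var v)) (w v)) ?_ ?_ h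
  · intro v v' he
    have h₁ := hp.1 _ he
    have h₂ : w v = w v' := hw.eqs _ he
    simp only at h₁
    rw [h₁, h₂]
  · intro P v v' hα h₁ h₂
    have h₃ : τ (.var v) = τ (.var v') := hp.2 _ _ _ hα fun h => h₁ h.1
    rw [h₃]
    rcases hw.atoms _ hα with h | h | h
    · exact (h₁ h.1).elim
    · have h : w v' = _ :: w v := h
      rw [h, cap_tail T 𝒜 h₁]
    · have h : w v = _ :: w v' := h
      rw [h, cap_tail T 𝒜 h₂]

variable [Nonempty Ind]

theorem canon_term {V : Type} (T : TBox Con Rol) (𝒜 : BagABox Ind Con Rol) (α : V → Ind)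
    (j : V → ℕ) (w : V → List (DLRole Rol)) (t : Term Ind V) :
    (canon.{u} T 𝒜).term (fun v => (⟨α v, j v, w v⟩ : Elem.{u} Ind Rol)) t =
      (⟨termRoot α t, termIdx j t, termWord w t⟩ : Elem.{u} Ind Rol) := by
  cases t <;> rfl

/-- The images of the terms of an atom are elements of the canonical model that are suitably
related. -/
def AtomGood (T : TBox Con Rol) (𝒜 : BagABox Ind Con Rol) {V : Type}
    (d : Term Ind V → Elem.{u} Ind Rol) : Atom Ind V Con Rol → Prop
  | .con A t => (d t).Valid T 𝒜 ∧ ∀ R ∈ (d t).word.head?, T.Sub (.ex R.swap) (.atomic A)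
  | .rol P t₁ t₂ => ((d t₁).Valid T 𝒜 ∧ (d t₂).Valid T 𝒜) ∧
    (((d t₁).word = [] ∧ (d t₂).word = []) ∨
      Elem.Child (.atomic P) (d t₁) (d t₂) ∨ Elem.Child (.inv P) (d t₂) (d t₁))

/-- Separates a 0-1 condition on the position of the terms from a numerical factor that does not
involve copy numbers. -/
theorem canon_atom {V : Type} (T : TBox Con Rol) (𝒜 : BagABox Ind Con Rol) (α : V → Ind)
    (j : V → ℕ) (w : V → List (DLRole Rol)) (β : Atom Ind V Con Rol) :
    (canon.{u} T 𝒜).atom (fun v => (⟨α v, j v, w v⟩ : Elem.{u} Ind Rol)) β =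
      iv (AtomGood T 𝒜 (fun t => (⟨termRoot α t, termIdx j t, termWord w t⟩ : Elem.{u} Ind Rol)) β) *
        atomVal w T 𝒜 (termRoot α) β := by
  cases β with
  | con A t =>
    change (canon.{u} T 𝒜).concept (.atomic A) _ = _
    rw [canon_term, canon_concept]
    simp only [AtomGood, iv_and, Elem.tp, atomVal]
    cases termWord w t <;> simp
  | rol P t₁ t₂ =>
    change (canon.{u} T 𝒜).role (.atomic P) (_, _) = _
    rw [canon_term, canon_term, canon_role]
    simp only [AtomGood, atomVal, iv_and, mul_assoc]
    by_cases h : termWord w t₁ = [] ∧ termWord w t₂ = []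
    · simp only [Elem.edge, h, and_self, if_true, true_or, iv_of, one_mul]
      rfl
    · rw [edge_of_ne_nil _ (not_and_or.1 h), if_neg h, mul_one]
      simp only [h, false_or]
      rfl

theorem list_prod_iv {ι : Type*} (l : List ι) (p : ι → Prop) (f : ι → ℕ∞) :
    (l.map fun i => iv (p i) * f i).prod = iv (∀ i ∈ l, p i) * (l.map f).prod := by
  induction l with
  | nil => simp
  | cons i l ih =>
    rw [List.map_cons, List.prod_cons, ih, iv_congr List.forall_mem_cons, iv_and, List.map_cons,
      List.prod_cons]
    ring

variable (q T w)

open Classical in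
/-- The number of matches with given words that map the terms below given individuals. -/
noncomputable def body (𝒜 : BagABox Ind Con Rol) (τ : Term Ind q.V → Ind) : ℕ∞ :=
  iv (∀ p ∈ pairs q w, τ p.1 = τ p.2) * ((q.atoms.map (atomVal w T 𝒜 τ)).prod *
    ∏ c : Quotient (copySetoid q w), cap T 𝒜 (τ (.var c.out)) (w c.out))

/-- Decouples the conditions on a match: those on words, those on individuals, and finally those on
copy numbers, the only ones left to count over. -/
theorem match_iff (𝒜 : BagABox Ind Con Rol) (a : {v // v ∈ q.ans} → Ind) (α : q.V → Ind)
    (j : q.V → ℕ) :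
    (((∀ (v : Vars) (h : v ∈ q.ans),
      (⟨α ⟨v, Finset.mem_union_left _ h⟩, j ⟨v, Finset.mem_union_left _ h⟩,
        w ⟨v, Finset.mem_union_left _ h⟩⟩ : Elem.{u} Ind Rol) = ⟨a ⟨v, h⟩, 0, []⟩) ∧
      ∀ e ∈ q.eqs, (⟨α e.1, j e.1, w e.1⟩ : Elem.{u} Ind Rol) =
        ⟨termRoot α e.2, termIdx j e.2, termWord w e.2⟩) ∧
      ∀ β ∈ q.atoms, AtomGood T 𝒜
        (fun t => (⟨termRoot α t, termIdx j t, termWord w t⟩ : Elem.{u} Ind Rol)) β) ↔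
    (((∀ (v : Vars) (h : v ∈ q.ans), α ⟨v, Finset.mem_union_left _ h⟩ = a ⟨v, h⟩) ∧
      Words q T w) ∧ ∀ p ∈ pairs q w, termRoot α p.1 = termRoot α p.2) ∧
      (∀ v v', copySetoid q w v v' → j v = j v') ∧
        ∀ v, (j v : ℕ∞) < cap T 𝒜 (α v) (w v) := by
  rw [forall_pairs]
  simp only [Elem.mk.injEq]
  constructor
  · rintro ⟨⟨hans, heq⟩, hat⟩
    have hterm : ∀ β ∈ q.atoms, ∀ t, β.Mentions t →
        (⟨termRoot α t, termIdx j t, termWord w t⟩ : Elem.{u} Ind Rol).Valid T 𝒜 := by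
      intro β hβ t ht
      cases β with
      | con A t =>
        obtain rfl := ht
        exact (hat _ hβ).1
      | rol P t₁ t₂ =>
        rcases ht with rfl | rfl
        · exact (hat _ hβ).1.1
        · exact (hat _ hβ).1.2
    -- Atoms force validity of the terms they mention; safety carries it to every variable.
    have hval : ∀ v, (⟨α v, j v, w v⟩ : Elem.{u} Ind Rol).Valid T 𝒜 := by
      intro v
      obtain ⟨t, ht, β, hβ, hm⟩ := q.safe v
      have := eq_of_termSetoid (f := fun t =>
        (⟨termRoot α t, termIdx j t, termWord w t⟩ : Elem.{u} Ind Rol))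
        (fun e he => by rw [Elem.mk.injEq]; exact heq e he) ht
      exact this ▸ hterm β hβ t hm
    refine ⟨⟨⟨fun v h => (hans v h).1, ?_⟩, fun e he => (heq e he).1, ?_⟩, ?_, fun v => (hval v).1⟩
    · refine ⟨fun v => (hval v).2, fun v h => (hans v h).2.2, fun e he => (heq e he).2.2, ?_⟩
      intro β hβ
      cases β with
      | con A t => exact (hat _ hβ).2
      | rol P t₁ t₂ =>
        rcases (hat _ hβ).2 with h | h | h
        · exact Or.inl h
        · exact Or.inr (Or.inl h.2.1)
        · exact Or.inr (Or.inr h.2.1)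
    · intro P t₁ t₂ hβ hw
      rcases (hat _ hβ).2 with h | h | h
      · exact (hw h).elim
      · exact h.1
      · exact h.1.symm
    · intro v v' h
      refine copySetoid_induction ?_ ?_ h
      · exact fun v v' he => (heq _ he).2.1
      · intro P v v' hβ h₁ h₂
        rcases (hat _ hβ).2 with h | h | h
        · exact (h₁ h.1).elim
        · exact h.2.2 h₁
        · exact (h.2.2 h₂).symm
  · rintro ⟨⟨⟨hans, hw⟩, hp₁, hp₂⟩, hj, hcap⟩
    have hzero : ∀ v, w v = [] → j v = 0 := by
      intro v hv
      have := hcap v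
      rw [hv] at this
      simpa [cap] using this
    have hval : ∀ t, (⟨termRoot α t, termIdx j t, termWord w t⟩ : Elem.{u} Ind Rol).Valid T 𝒜 := by
      intro t
      cases t with
      | var v => exact ⟨hcap v, hw.chain v⟩
      | ind c => exact (Elem.valid_of_word_eq_nil T 𝒜 rfl).2 rfl
    have hchild : ∀ P t₁ t₂, Atom.rol P t₁ t₂ ∈ q.atoms → termWord w t₁ ≠ [] →
        termWord w t₂ ≠ [] → termIdx j t₁ = termIdx j t₂ := by
      intro P t₁ t₂ hβ h₁ h₂
      cases t₁ with
      | ind c => exact (h₁ rfl).elim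
      | var v =>
        cases t₂ with
        | ind c => exact (h₂ rfl).elim
        | var v' => exact hj v v' (.rel _ _ (Or.inr ⟨P, hβ, h₁, h₂⟩))
    refine ⟨⟨fun v h => ⟨hans v h, hzero _ (hw.ans v h), hw.ans v h⟩,
      fun e he => ⟨hp₁ e he, ?_, hw.eqs e he⟩⟩, ?_⟩
    · obtain ⟨v, t⟩ := e
      cases t with
      | var v' => exact hj v v' (.rel _ _ (Or.inl he))
      | ind c => exact hzero v (hw.eqs _ he)
    · intro β hβ
      cases β with
      | con A t => exact ⟨hval t, hw.atoms _ hβ⟩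
      | rol P t₁ t₂ =>
        refine ⟨⟨hval t₁, hval t₂⟩, ?_⟩
        rcases hw.atoms _ hβ with h | h | h
        · exact Or.inl h
        · exact Or.inr (Or.inl ⟨hp₂ P t₁ t₂ hβ (by simp [h]), h,
            fun h₁ => hchild P t₁ t₂ hβ h₁ (by simp [h])⟩)
        · exact Or.inr (Or.inr ⟨(hp₂ P t₁ t₂ hβ (by simp [h])).symm, h,
            fun h₂ => (hchild P t₁ t₂ hβ (by simp [h]) h₂).symm⟩)

/-- The number of matches of a query in the canonical model with given words that map the variables
below given individuals. -/
theorem bagSum_copies (𝒜 : BagABox Ind Con Rol) (a : {v // v ∈ q.ans} → Ind) (α : q.V → Ind) :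
    (bagSum fun j : q.V → ℕ => iv ((∀ (v : Vars) (h : v ∈ q.ans),
      (⟨α ⟨v, Finset.mem_union_left _ h⟩, j ⟨v, Finset.mem_union_left _ h⟩,
        w ⟨v, Finset.mem_union_left _ h⟩⟩ : Elem.{u} Ind Rol) = ⟨a ⟨v, h⟩, 0, []⟩) ∧
      ∀ e ∈ q.eqs, (⟨α e.1, j e.1, w e.1⟩ : Elem.{u} Ind Rol) =
        ⟨termRoot α e.2, termIdx j e.2, termWord w e.2⟩) *
      (q.atoms.map ((canon.{u} T 𝒜).atom
        fun v => (⟨α v, j v, w v⟩ : Elem.{u} Ind Rol))).prod) =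
    iv (Words q T w) *
      (iv (∀ (v : Vars) (h : v ∈ q.ans), α ⟨v, Finset.mem_union_left _ h⟩ = a ⟨v, h⟩) *
        body q T w 𝒜 (termRoot α)) := by
  classical
  have hfun : ∀ j : q.V → ℕ, (canon.{u} T 𝒜).atom (V := q.V)
      (fun v => (⟨α v, j v, w v⟩ : Elem.{u} Ind Rol)) = fun β =>
      iv (AtomGood T 𝒜 (fun t => (⟨termRoot α t, termIdx j t, termWord w t⟩ : Elem.{u} Ind Rol)) β) *
        atomVal w T 𝒜 (termRoot α) β := fun j => funext fun β => canon_atom T 𝒜 α j w β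
  simp only [hfun, list_prod_iv]
  simp only [← mul_assoc, ← iv_and, match_iff q T w 𝒜 a α]
  simp only [mul_comm _ (List.prod _), iv_and, bagSum_mul_left]
  -- Constancy of `cap` on copy classes is available only under these conditions; otherwise both
  -- sides vanish.
  by_cases h : Words q T w ∧ ∀ p ∈ pairs q w, termRoot α p.1 = termRoot α p.2
  · have := bagSum_classes (copySetoid q w) (fun v => cap T 𝒜 (α v) (w v)) fun v v' hv =>
      cap_eq_of_copySetoid h.1 h.2 hv
    simp only [iv_and] at this
    rw [this, body, iv_of h.1, iv_of h.2]
    simp only [mul_one, one_mul]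
    rw [mul_left_comm]
    rfl
  · rw [body]
    rcases not_and_or.1 h with h | h <;>
      rw [iv_of_not h] <;> simp only [mul_zero, zero_mul]

end Count

end

/-! ### Finiteness of the families of words -/

section

variable {Ind Vars Con Rol : Type} [DecidableEq Vars]

section Finiteness

variable {q : CQ Ind Vars Con Rol} (T : TBox Con Rol)

/-- Only finitely many words are possible for the variables of a rooted query. -/
theorem finite_words (hq : q.Rooted) : {w | Words q T w}.Finite := by
  have key : ∀ v : q.V, {u | ∃ w, Words q T w ∧ ∃ t, (Quotient.mk _ t : q.Node) =
      Quotient.mk _ (.var v) ∧ termWord w t = u}.Finite := by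
    have hcls : ∀ {w} (_ : Words q T w) {s t : Term Ind q.V},
        (Quotient.mk _ s : q.Node) = Quotient.mk _ t → termWord w s = termWord w t :=
      fun hw _ _ h => eq_of_termSetoid (f := termWord _) hw.eqs (Quotient.exact h)
    -- Roots carry the empty word, and across a role atom the words are equal or differ by one
    -- letter fixed by the atom. Finiteness thus spreads along the Gaifman graph.
    refine hq.induction (p := fun c => {u | ∃ w, Words q T w ∧ ∃ t, (Quotient.mk _ t : q.Node) =
      c ∧ termWord w t = u}.Finite) ?_ ?_
    · intro s hs
      refine (Set.finite_singleton []).subset ?_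
      rintro _ ⟨w, hw, t, ht, rfl⟩
      rw [hcls hw ht]
      cases s with
      | var v => exact hw.ans v.1 hs
      | ind c => rfl
    · intro P t₁ t₂ hβ
      have hstep : ∀ {w}, Words q T w → termWord w t₁ = termWord w t₂ ∨
          termWord w t₂ = .atomic P :: termWord w t₁ ∨
          termWord w t₁ = .inv P :: termWord w t₂ := by
        intro w hw
        rcases hw.atoms _ hβ with h | h | h
        · exact Or.inl (h.1.trans h.2.symm)
        · exact Or.inr (Or.inl h)
        · exact Or.inr (Or.inr h)
      constructor <;> intro hfin
      · refine ((hfin.union (hfin.image (.atomic P :: ·))).union (hfin.image List.tail)).subset ?_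
        rintro _ ⟨w, hw, t, ht, rfl⟩
        rw [hcls hw ht]
        rcases hstep hw with h | h | h
        · exact Or.inl (Or.inl ⟨w, hw, t₁, rfl, h⟩)
        · exact Or.inl (Or.inr ⟨_, ⟨w, hw, t₁, rfl, rfl⟩, h.symm⟩)
        · exact Or.inr ⟨_, ⟨w, hw, t₁, rfl, rfl⟩, by rw [h]; rfl⟩
      · refine ((hfin.union (hfin.image (.inv P :: ·))).union (hfin.image List.tail)).subset ?_
        rintro _ ⟨w, hw, t, ht, rfl⟩
        rw [hcls hw ht]
        rcases hstep hw with h | h | h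
        · exact Or.inl (Or.inl ⟨w, hw, t₂, rfl, h.symm⟩)
        · exact Or.inr ⟨_, ⟨w, hw, t₂, rfl, rfl⟩, by rw [h]; rfl⟩
        · exact Or.inl (Or.inr ⟨_, ⟨w, hw, t₂, rfl, rfl⟩, h.symm⟩)
  refine (Set.Finite.pi' key).subset fun w hw v => ?_
  exact ⟨w, hw, .var v, rfl, rfl⟩

theorem finite_occurs : {t | q.Occurs t}.Finite := by
  have h₁ : ∀ β : Atom Ind q.V Con Rol, {t | β.Mentions t}.Finite := by
    intro β
    cases β with
    | con A t => exact Set.finite_singleton t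
    | rol P t₁ t₂ => exact Set.toFinite {t₁, t₂}
  have h₂ := (List.finite_toSet q.atoms).biUnion fun β _ => h₁ β
  have h₃ := (List.finite_toSet q.eqs).biUnion fun e _ =>
    (Set.toFinite {Term.var (Ind := Ind) e.1, e.2})
  refine (h₂.union h₃).subset ?_
  rintro t (⟨β, hβ, ht⟩ | ⟨e, he, ht⟩)
  · exact Or.inl (Set.mem_biUnion hβ ht)
  · exact Or.inr (Set.mem_biUnion (x := e) he (by simpa using ht))

end Finiteness

/-! ### Assembling the rewriting -/

section Main

variable [Nonempty Ind] {q : CQ Ind Vars Con Rol} {T : TBox Con Rol}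

/-- Families of canonical elements as triples of families. -/
def familyEquiv (V Ind Rol : Type) :
    (V → List (DLRole Rol)) × (V → Ind) × (V → ℕ) ≃ (V → Elem.{u} Ind Rol) where
  toFun p v := ⟨p.2.1 v, p.2.2 v, p.1 v⟩
  invFun lam := (fun v => (lam v).word, fun v => (lam v).root, fun v => (lam v).idx)
  left_inv _ := rfl
  right_inv _ := rfl

/-- Sum over copy numbers first, by `bagSum_copies`, then over individuals and words. Even a
variable with an anonymous image is summed over `Ind`, namely over the individual above that image.
-/
theorem canon_answers (T : TBox Con Rol) (hq : q.Rooted) (𝒜 : BagABox Ind Con Rol) (a : {v // v ∈ q.ans} → Ind) :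
    q.answers (canon.{u} T 𝒜) a = ∑ w ∈ (finite_words T hq).toFinset,
      bagSum fun b : {v // v ∈ q.ex} → Ind => body q T w 𝒜 (termRoot fun v =>
        if h : v.1 ∈ q.ex then b ⟨v.1, h⟩
        else a ⟨v.1, (Finset.mem_union.1 v.2).resolve_right h⟩) := by
  have h₁ : q.answers (canon.{u} T 𝒜) a = bagSum fun lam : q.V → Elem.{u} Ind Rol =>
      iv ((∀ (v : Vars) (h : v ∈ q.ans), lam ⟨v, Finset.mem_union_left _ h⟩ =
        (⟨a ⟨v, h⟩, 0, []⟩ : Elem.{u} Ind Rol)) ∧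
        ∀ e ∈ q.eqs, lam e.1 = (canon.{u} T 𝒜).term lam e.2) *
      (q.atoms.map ((canon.{u} T 𝒜).atom lam)).prod :=
    bagSum_subtype _ fun lam : q.V → Elem.{u} Ind Rol =>
      (q.atoms.map ((canon.{u} T 𝒜).atom lam)).prod
  rw [h₁, ← bagSum_equiv (familyEquiv q.V Ind Rol), bagSum_prod]
  have h₂ : ∀ w : q.V → List (DLRole Rol), (bagSum fun p : (q.V → Ind) × (q.V → ℕ) =>
      iv ((∀ (v : Vars) (h : v ∈ q.ans),
        familyEquiv q.V Ind Rol (w, p) ⟨v, Finset.mem_union_left _ h⟩ =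
        (⟨a ⟨v, h⟩, 0, []⟩ : Elem.{u} Ind Rol)) ∧
        ∀ e ∈ q.eqs, familyEquiv q.V Ind Rol (w, p) e.1 =
          (canon.{u} T 𝒜).term (familyEquiv q.V Ind Rol (w, p)) e.2) *
      (q.atoms.map ((canon.{u} T 𝒜).atom (familyEquiv q.V Ind Rol (w, p)))).prod) =
      iv (Words q T w) * bagSum fun α : q.V → Ind =>
        iv (∀ (v : Vars) (h : v ∈ q.ans), α ⟨v, Finset.mem_union_left _ h⟩ = a ⟨v, h⟩) *
        body q T w 𝒜 (termRoot α) := by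
    intro w
    rw [bagSum_prod, ← bagSum_mul_left]
    refine congrArg bagSum (funext fun α => ?_)
    rw [← bagSum_copies.{u}]
    refine congrArg bagSum (funext fun j => ?_)
    refine congrArg (· * _) (iv_congr (and_congr Iff.rfl (forall₂_congr fun e _ => ?_)))
    exact Eq.congr_right (canon_term T 𝒜 α j w e.2)
  refine (congrArg bagSum (funext h₂)).trans ?_
  rw [bagSum_eq_sum (finite_words T hq).toFinset]
  · refine Finset.sum_congr rfl fun w hw => ?_
    rw [iv_of (by simpa using hw), one_mul]
    rw [bagSum_of_injective (g := fun (b : {v // v ∈ q.ex} → Ind) (v : q.V) =>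
      if h : v.1 ∈ q.ex then b ⟨v.1, h⟩
        else a ⟨v.1, (Finset.mem_union.1 v.2).resolve_right h⟩)]
    · refine congrArg bagSum (funext fun b => ?_)
      rw [iv_of, one_mul]
      intro v h
      exact dif_neg (Finset.disjoint_left.1 q.disjoint h)
    · intro b b' h
      funext v
      have := congrFun h ⟨v.1, Finset.mem_union_right _ v.2⟩
      simpa [v.2] using this
    · intro α hα
      have hα := iv_ne_zero.1 (left_ne_zero_of_mul hα)
      refine ⟨fun v => α ⟨v.1, Finset.mem_union_right _ v.2⟩, ?_⟩
      funext v
      by_cases h : v.1 ∈ q.ex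
      · exact dif_pos h
      · exact (dif_neg h).trans (hα v.1 _).symm
  · intro w hw
    rw [iv_of_not (by simpa using hw), zero_mul]

/-- The body is expressible when every individual of the query is replaced by a variable. -/
theorem expressible_body [Infinite Vars] {w : q.V → List (DLRole Rol)} (hw : Words q T w)
    {nu : Ind → Vars} (D : Finset Ind) (hD : ∀ c, q.Occurs (.ind c) → c ∈ D)
    (hD' : ∀ c ∈ D, q.Occurs (.ind c)) :
    Expressible ((q.ans ∪ q.ex) ∪ D.image nu) fun (𝒜 : BagABox Ind Con Rol) (a : Vars → Ind) =>
      body q T w 𝒜 fun t => match t with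
        | .var v => a v.1
        | .ind c => a (nu c) := by
  classical
  set name : Term Ind q.V → Vars := fun t => match t with
    | .var v => v.1
    | .ind c => nu c with hname
  set X := (q.ans ∪ q.ex) ∪ D.image nu
  have hX : ∀ t, q.Occurs t → name t ∈ X := by
    intro t ht
    cases t with
    | var v => exact Finset.mem_union_left _ v.2
    | ind c => exact Finset.mem_union_right _ (Finset.mem_image_of_mem _ (hD c ht))
  -- `Y₁` collects the variables of atoms lying on individuals, `Y₂` the representatives of copy
  -- classes with nonempty word; the remaining variables must come in through equalities.
  obtain ⟨Y₁, hY₁, h₁⟩ := ExpressibleOrOne.list_prod q.atoms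
    (Z := fun β => match β with
      | .con _ t => if termWord w t = [] then {name t} else ∅
      | .rol _ t₁ t₂ => if termWord w t₁ = [] ∧ termWord w t₂ = [] then {name t₁, name t₂} else ∅)
    (F := fun β (𝒜 : BagABox Ind Con Rol) a => atomVal w T 𝒜 (fun t => a (name t)) β) (by
      intro β _
      cases β with
      | con A t =>
        by_cases h : termWord w t = []
        · simp only [atomVal, h, if_true]
          exact Or.inl (Expressible.closure T (.atomic A) (name t))
        · simp only [atomVal, h, if_false]
          exact ExpressibleOrOne.one
      | rol P t₁ t₂ =>
        by_cases h : termWord w t₁ = [] ∧ termWord w t₂ = []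
        · simp only [atomVal, if_pos h]
          exact Or.inl (Expressible.rol P (name t₁) (name t₂))
        · simp only [atomVal, if_neg h]
          exact ExpressibleOrOne.one)
  obtain ⟨Y₂, hY₂, h₂⟩ := ExpressibleOrOne.list_prod
    (Finset.univ : Finset (Quotient (copySetoid q w))).toList
    (Z := fun c => if w c.out = [] then ∅ else {c.out.1})
    (F := fun c (𝒜 : BagABox Ind Con Rol) a => cap T 𝒜 (a c.out.1) (w c.out)) (by
      intro c _
      by_cases h : w c.out = []
      · simp only [h, if_true]
        exact ExpressibleOrOne.one
      · simp only [h, if_false]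
        exact Or.inl (Expressible.cap T h c.out.1))
  have h := h₁.mul h₂
  set Y := Y₁ ∪ Y₂
  have hYX : Y ⊆ X := by
    intro x hx
    rcases Finset.mem_union.1 hx with hx | hx
    · obtain ⟨β, hβ, hx⟩ := (hY₁ x).1 hx
      cases β with
      | con A t =>
        by_cases h : termWord w t = []
        · simp only [h, if_true, Finset.mem_singleton] at hx
          exact hx ▸ hX t (Or.inl ⟨_, hβ, rfl⟩)
        · simp [h] at hx
      | rol P t₁ t₂ =>
        by_cases h : termWord w t₁ = [] ∧ termWord w t₂ = []
        · simp only [if_pos h, Finset.mem_insert, Finset.mem_singleton] at hx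
          rcases hx with rfl | rfl
          · exact hX t₁ (Or.inl ⟨_, hβ, Or.inl rfl⟩)
          · exact hX t₂ (Or.inl ⟨_, hβ, Or.inr rfl⟩)
        · simp [if_neg h] at hx
    · obtain ⟨c, -, hx⟩ := (hY₂ x).1 hx
      by_cases h : w c.out = []
      · simp [h] at hx
      · simp only [h, if_false, Finset.mem_singleton] at hx
        exact hx ▸ Finset.mem_union_left _ c.out.2
  have hforall : ∀ a : Vars → Ind,
      (∀ e ∈ (pairs q w).map fun p => (name p.1, name p.2), a e.1 = a e.2) ↔
      ∀ p ∈ pairs q w, a (name p.1) = a (name p.2) := fun a => by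
    rw [List.forall_mem_map]
  -- Modulo the equalities, every term that occurs equals a variable in `Y`.
  have hnull : ∀ t, termWord w t ≠ [] → ∃ y ∈ Y, ∀ a : Vars → Ind,
      (∀ p ∈ pairs q w, a (name p.1) = a (name p.2)) → a (name t) = a y := by
    intro t ht
    cases t with
    | ind c => exact (ht rfl).elim
    | var v =>
      have hc : copySetoid q w (Quotient.mk (copySetoid q w) v).out v := Quotient.mk_out v
      have hne : w (Quotient.mk (copySetoid q w) v).out ≠ [] := by
        have hiff := copySetoid_induction (f := fun v => (w v = [] : Prop)) (fun v v' he => ?_)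
          (fun P v v' _ h₁ h₂ => by simp [h₁, h₂]) hc
        · rw [ne_eq, hiff]
          exact ht
        · have : w v = w v' := hw.eqs _ he
          rw [this]
      refine ⟨(Quotient.mk (copySetoid q w) v).out.1, Finset.mem_union_right _ ((hY₂ _).2
        ⟨Quotient.mk (copySetoid q w) v, by simp, by simp [hne]⟩), fun a ha => ?_⟩
      rw [forall_pairs] at ha
      refine (copySetoid_induction (f := fun v : q.V => a v.1) (fun v v' he => ha.1 _ he)
        (fun P v v' hβ h₁ h₂ => ha.2 P _ _ hβ fun h => h₁ h.1) hc).symm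
  have hatom : ∀ β ∈ q.atoms, ∀ t, β.Mentions t → ∃ y ∈ Y, ∀ a : Vars → Ind,
      (∀ p ∈ pairs q w, a (name p.1) = a (name p.2)) → a (name t) = a y := by
    intro β hβ t ht
    by_cases h : termWord w t = []
    swap
    · exact hnull t h
    cases β with
    | con A t' =>
      obtain rfl : t = t' := ht
      exact ⟨name t, Finset.mem_union_left _ ((hY₁ _).2 ⟨_, hβ, by simp [h]⟩), fun _ _ => rfl⟩
    | rol P t₁ t₂ =>
      by_cases h' : termWord w t₁ = [] ∧ termWord w t₂ = []
      · refine ⟨name t, Finset.mem_union_left _ ((hY₁ _).2 ⟨_, hβ, ?_⟩), fun _ _ => rfl⟩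
        simp only [if_pos h', Finset.mem_insert, Finset.mem_singleton]
        exact ht.imp (congrArg name) (congrArg name)
      · rcases ht with rfl | rfl
        · obtain ⟨y, hy, hy'⟩ := hnull t₂ fun h₂ => h' ⟨h, h₂⟩
          refine ⟨y, hy, fun a ha => Eq.trans ?_ (hy' a ha)⟩
          exact (forall_pairs.1 ha).2 P _ _ hβ h'
        · obtain ⟨y, hy, hy'⟩ := hnull t₁ fun h₁ => h' ⟨h₁, h⟩
          refine ⟨y, hy, fun a ha => Eq.trans ?_ (hy' a ha)⟩
          exact ((forall_pairs.1 ha).2 P _ _ hβ h').symm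
  have hvar : ∀ v : q.V, ∃ y ∈ Y, ∀ a : Vars → Ind,
      (∀ p ∈ pairs q w, a (name p.1) = a (name p.2)) → a v.1 = a y := by
    intro v
    obtain ⟨t, ht, β, hβ, hm⟩ := q.safe v
    obtain ⟨y, hy, hy'⟩ := hatom β hβ t hm
    refine ⟨y, hy, fun a ha => Eq.trans ?_ (hy' a ha)⟩
    exact eq_of_termSetoid (f := fun t => a (name t)) (fun e he => (forall_pairs.1 ha).1 e he) ht
  have hcover : ∀ x ∈ X, ∃ y ∈ Y, ∀ a : Vars → Ind,
      (∀ e ∈ (pairs q w).map fun p => (name p.1, name p.2), a e.1 = a e.2) → a x = a y := by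
    simp only [hforall]
    intro x hx
    rcases Finset.mem_union.1 hx with hx | hx
    · exact hvar ⟨x, hx⟩
    · obtain ⟨c, hc, rfl⟩ := Finset.mem_image.1 hx
      rcases hD' c hc with ⟨β, hβ, hm⟩ | ⟨e, he, h | h⟩
      · exact hatom β hβ _ hm
      · cases h
      · obtain ⟨y, hy, hy'⟩ := hvar e.1
        refine ⟨y, hy, fun a ha => Eq.trans ?_ (hy' a ha)⟩
        have := (forall_pairs.1 ha).1 e he
        simp only [← h] at this
        exact this.symm
  -- The conjunction has an atom, so `Y` is nonempty and the product is not the trivial one.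
  have hexp := h.resolve_right fun hY => by
    obtain ⟨β, hβ⟩ := List.exists_mem_of_ne_nil _ q.atoms_ne_nil
    have : ∃ t, β.Mentions t := by
      cases β with
      | con A t => exact ⟨t, rfl⟩
      | rol P t₁ t₂ => exact ⟨t₁, Or.inl rfl⟩
    obtain ⟨t, ht⟩ := this
    obtain ⟨y, hy, -⟩ := hatom β hβ t ht
    rw [hY.1] at hy
    simp at hy
  refine (hexp.equalities hYX ((pairs q w).map fun p => (name p.1, name p.2)) ?_ hcover).congr
    fun 𝒜 a => ?_
  · rw [List.forall_mem_map, forall_pairs]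
    refine ⟨fun e he => ⟨hX _ (Or.inr ⟨e, he, Or.inl rfl⟩), hX _ (Or.inr ⟨e, he, Or.inr rfl⟩)⟩,
      fun P t₁ t₂ hβ _ => ⟨hX _ (Or.inl ⟨_, hβ, Or.inl rfl⟩), hX _ (Or.inl ⟨_, hβ, Or.inr rfl⟩)⟩⟩
  · have hτ : (fun t : Term Ind q.V => match t with
        | .var v => a v.1
        | .ind c => a (nu c)) = fun t => a (name t) := by
      funext t
      cases t <;> rfl
    rw [hτ, body, Finset.prod_map_toList, iv_congr (hforall a)]

/-- Countability of `Ind` gives every individual its own variable outside the query; `fix` assigns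
these variables their individuals. -/
theorem expressible_body_termRoot [Infinite Vars] [Countable Ind] {w : q.V → List (DLRole Rol)}
    (hw : Words q T w) :
    Expressible (q.ans ∪ q.ex) fun (𝒜 : BagABox Ind Con Rol) (a : Vars → Ind) =>
      body q T w 𝒜 (termRoot fun v => a v.1) := by
  classical
  have : Infinite {x // x ∉ q.ans ∪ q.ex} :=
    (Finset.finite_toSet (q.ans ∪ q.ex)).infinite_compl.to_subtype
  obtain ⟨e, he⟩ := Countable.exists_injective_nat Ind
  let nu : Ind → Vars := fun c => (Infinite.natEmbedding {x // x ∉ q.ans ∪ q.ex} (e c)).1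
  have hnu : Function.Injective nu := fun c c' h =>
    he ((Infinite.natEmbedding _).injective (Subtype.ext h))
  have hnuX : ∀ c, nu c ∉ q.ans ∪ q.ex := fun c =>
    (Infinite.natEmbedding {x // x ∉ q.ans ∪ q.ex} (e c)).2
  let fix : (Vars → Ind) → Vars → Ind := fun a x => if h : ∃ c, nu c = x then h.choose else a x
  have hfix : ∀ a c, fix a (nu c) = c := fun a c => by
    have h : ∃ c', nu c' = nu c := ⟨c, rfl⟩
    exact (dif_pos h).trans (hnu h.choose_spec)
  have hfixX : ∀ a, ∀ x ∈ q.ans ∪ q.ex, fix a x = a x := fun a x hx =>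
    dif_neg fun ⟨c, hc⟩ => hnuX c (hc ▸ hx)
  have hfin : {c | q.Occurs (.ind c)}.Finite :=
    finite_occurs.preimage fun c _ c' _ h => Term.ind.inj h
  refine ((expressible_body (nu := nu) hw hfin.toFinset (by simp) (by simp)).pin_all hnu hnuX
    hfix hfixX).congr fun 𝒜 a => congrArg _ (funext fun t => ?_)
  cases t with
  | var v => exact hfixX a v.1 v.2
  | ind c => exact hfix a c

end Main

end

end BagDL

theorem corollary1 {Ind Vars Con Rol : Type}
    [Countable Ind] [Infinite Ind] [Countable Vars] [Infinite Vars] [DecidableEq Vars]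
    [Countable Con] [Infinite Con] [Countable Rol] [Infinite Rol]
    (q : BagDL.CQ Ind Vars Con Rol) (hq : q.Rooted) (T : BagDL.TBox Con Rol) :
    ∃ qbar : BagDL.BALG Ind Vars Con Rol q.ans,
      ∀ 𝒜 : BagDL.BagABox Ind Con Rol, BagDL.Satisfiable.{u} T 𝒜 →
        q.certain.{u} T 𝒜 = qbar.answers (BagDL.aboxInterp 𝒜) := by
  open BagDL in
  classical
  -- Needed for the zero query when no family of words is possible.
  obtain ⟨f, hf⟩ := Expressible.exists_expressible (Ind := Ind) (Con := Con) (Rol := Rol) q.ans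
  obtain ⟨Q, hQ⟩ := Expressible.finset_sum (finite_words T hq).toFinset hf fun w hw =>
    (expressible_body_termRoot (by simpa using hw)).exists_vars q.disjoint
  refine ⟨Q, fun 𝒜 hs => ?_⟩
  rw [certain_eq_canon hq hs]
  funext a
  -- The value outside the answer variables is irrelevant to `Q`.
  have hQa := hQ 𝒜 fun x => if h : x ∈ q.ans then a ⟨x, h⟩ else Classical.arbitrary Ind
  have ha : (fun v : {v // v ∈ q.ans} =>
      (if h : v.1 ∈ q.ans then a ⟨v.1, h⟩ else Classical.arbitrary Ind)) = a :=
    funext fun v => dif_pos v.2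
  rw [canon_answers T hq]
  refine Eq.trans ?_ ((hQa.symm).trans (congrArg (Q.eval (aboxInterp 𝒜)) ha))
  refine Finset.sum_congr rfl fun w _ => congrArg bagSum (funext fun b => ?_)
  refine congrArg _ (congrArg termRoot (funext fun v => ?_))
  by_cases h : v.1 ∈ q.ex
  · simp [h]
  · simp [h, (Finset.mem_union.1 v.2).resolve_right h]
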